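/- Let $F$ be a closed surface (a compact smooth 2-manifold without boundary). **Definitions.** For an immersion $g:F\to\mathbb R^3$ (all immersions are smooth), a point $p\in\mathbb R^3$ is *stable* if at most three sheets of $g$ pass through $p$ and their tangent planes are in general position; it is *unstable* otherwise. A *generic $m$-tuple point* ($m=4,5$) is a point through which exactly $m$ sheets pass, any three of them in general position. Let $I_n$ be the set of immersions whose unstable points are exactly $n$ generic quadruple points; $I_0$ is the set of generic immersions. A regular homotopy $H_t$ ($0\le t\le1$) is *generic* if $H_0,H_1\in I_0$ and at each time $H_t$ has at most one unstable point, at which a codimension one stratum (nondegenerate tangency of two sheets; quadratic tangency of a sheet with the double curve of two others, the three sheets being pairwise transverse; generic quadruple point) is crossed transversely. A *$q$-invariant* is a function $f:I_0\to\mathbb Z/2$ with $f(H_0)=f(H_1)$ for every generic regular homotopy $H_t$ with no quadruple points. It is extended to $\bigcup_n I_n$ by $$f(j)=\sum_{k=1}^{2^n} f(j_k)\qquad (j\in I_n),$$ where $j_1,\dots,j_{2^n}\in I_0$ are the generic immersions obtained by slightly deforming $j$, one for each choice, at every quadruple point, of one of the two ways of resolving it. (It is part of the claim below that for the immersions considered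 there these values are well defined.) **Theorem (the 10 term relation).** Let $i:F\to\mathbb R^3$ be an immersion whose unstable points are one generic quintuple point $p$ and a finite number $n$ of generic quadruple points. Let $S_1,\dots,S_5$ be the five sheets through $p$. For $k=1,\dots,5$ let $i_k^1$ and $i_k^2$ be obtained from $i$ by slightly pushing $S_k$ off $p$ to its one side and to its other side: $i_k^l=G_k^l(s)$ for a small $s>0$, where $G_k^l$ is a smooth deformation with $G_k^l(0)=i$ that keeps all sheets through unstable points of $i$, other than $S_k$ at $p$, fixed near these points, and the initial velocity of $G_k^l$ at the point $x_k\in F$ of the sheet $S_k$ with $i(x_k)=p$ is not tangent to $S_k$, pointing to opposite sides of the tangent plane of $S_k$ for $l=1$ and $l=2$. If these pushes are slight enough, then all ten $i_k^l$ lie in $I_{n+1}$, and for every $q$-invariant $f$ $$\sum_{k=1}^5\sum_{l=1}^2 f(i_k^l)=0\quad\text{in }\mathbb Z/2 .$$ -/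

import Mathlib

open Set Filter Topology
open scoped Manifold ContDiff

/-- The model space of surfaces. -/
abbrev Plane := EuclideanSpace ℝ (Fin 2)

/-- Euclidean 3-space. -/
abbrev Space := EuclideanSpace ℝ (Fin 3)

/-- Linear functionals on 3-space. -/
abbrev Covector := Space →L[ℝ] ℝ

section Immersions

variable {F : Type*} [TopologicalSpace F] [ChartedSpace Plane F]

/-- The differential of `g : F → ℝ³` at `x`; the tangent space of `F` at `x` is identified with
`ℝ²` by the preferred chart at `x`, as always in Mathlib. -/
noncomputable def differential (g : F → Space) (x : F) : Plane →L[ℝ] Space :=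
  mfderiv (𝓡 2) 𝓘(ℝ, Space) g x

/-- A smooth immersion of the surface `F` in `ℝ³`: a smooth map with injective differentials. -/
def IsSurfaceImmersion (g : F → Space) : Prop :=
  ContMDiff (𝓡 2) 𝓘(ℝ, Space) ∞ g ∧ ∀ x, Function.Injective (differential g x)

/-- The tangent plane, as a linear subspace of `ℝ³`, of the sheet of `g` through `g x` that is
the image of a small neighbourhood of `x`. -/
noncomputable def sheetPlane (g : F → Space) (x : F) : Submodule ℝ Space :=
  LinearMap.range (differential g x).toLinearMap

/-- The sheets at the points of the finite set `A` are in general position: the intersection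
of their tangent planes has codimension `A.card` in `ℝ³`. -/
def InGeneralPosition (g : F → Space) (A : Finset F) : Prop :=
  Module.finrank ℝ (⨅ x ∈ A, sheetPlane g x : Submodule ℝ Space) + A.card = 3

/-- Any at most three of the sheets of `g` that pass through `p` are in general position. -/
def SheetsGeneric (g : F → Space) (p : Space) : Prop :=
  ∀ A : Finset F, (∀ x ∈ A, g x = p) → A.card ≤ 3 → InGeneralPosition g A

/-- The self-intersection of `g` at `p` is stable: at most three sheets pass through `p`, and they
are in general position (`p` is off the image, or an embedded point, or a transverse double
point, or a transverse triple point). -/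
def StableAt (g : F → Space) (p : Space) : Prop :=
  (g ⁻¹' {p}).encard ≤ 3 ∧ SheetsGeneric g p

/-- The unstable self-intersection of `g`. -/
def unstablePoints (g : F → Space) : Set Space := {p | ¬ StableAt g p}

/-- `p` is a generic `m`-tuple point of `g`: exactly `m` sheets pass through `p`, and any three of
them are in general position. (Used for quadruple points, `m = 4`, and for quintuple points,
`m = 5`.) -/
def IsGenericMultiplePoint (m : ℕ) (g : F → Space) (p : Space) : Prop :=
  (g ⁻¹' {p}).encard = m ∧ SheetsGeneric g p

variable (F) in
/-- `QuadImm F n` is the set of immersions of `F` in `ℝ³` whose unstable self-intersection consists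
of precisely `n` generic quadruple points. In particular `QuadImm F 0` is the set of generic
(stable) immersions. -/
def QuadImm (n : ℕ) : Set (F → Space) :=
  {g | IsSurfaceImmersion g ∧ (unstablePoints g).encard = n ∧
    ∀ p ∈ unstablePoints g, IsGenericMultiplePoint 4 g p}

/-! ### Generic regular homotopies -/

/-- A smooth homotopy `H_t : F → ℝ³`, `0 ≤ t ≤ 1`, that is, a smooth map on `[0,1] × F`. (The
values of `H` at parameters outside `[0,1]` play no role.) -/
def IsSmoothHomotopy (H : ℝ → F → Space) : Prop :=
  ContMDiffOn (𝓘(ℝ, ℝ).prod (𝓡 2)) 𝓘(ℝ, Space) ∞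
    (fun z : ℝ × F => H z.1 z.2) (Icc (0 : ℝ) 1 ×ˢ univ)

/-- A regular homotopy: a smooth homotopy through immersions. -/
def IsRegularHomotopy (H : ℝ → F → Space) : Prop :=
  IsSmoothHomotopy H ∧ ∀ t ∈ Icc (0 : ℝ) 1, IsSurfaceImmersion (H t)

/-- The velocity `∂H_t(x)/∂t`. -/
noncomputable def velocity (H : ℝ → F → Space) (t : ℝ) (x : F) : Space :=
  derivWithin (fun s => H s x) (Icc (0 : ℝ) 1) t

/-- `ν` vanishes on the tangent plane of the sheet of `g` at `x`. -/
def IsConormal (g : F → Space) (x : F) (ν : Covector) : Prop :=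
  ∀ v : Plane, ν (differential g x v) = 0

/-- A linear relation among conormals of the sheets of `g` through `p`: to each `x` in a finite
part of the fibre of `g` over `p` a conormal `l x` of the sheet at `x` is assigned, and the sum of
all the `l x` is `0`. The sheets through `p` are in general position if and only if the only such
relation is `0`; at a generic quadruple point the relations form a line. -/
structure IsConormalRelation (g : F → Space) (p : Space) (l : F →₀ Covector) : Prop where
  mem_fiber : ∀ x ∈ l.support, g x = p
  conormal : ∀ x, IsConormal g x (l x)
  sum_eq_zero : (l.sum fun _ ν => ν) = 0

/-- The pairing `∑ l x (∂H_t(x)/∂t)` of a relation `l` at a point `p` of `H_t` with the velocity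
of `H` at time `t`. To first order the sheets of `H_{t+s}` near `p` are the planes
`l x (y - p) = s * l x (∂H_t(x)/∂t)`. So, when `l` spans the relations of a configuration of
sheets, a nonzero value means that the configuration (for instance the quadruple point) is
destroyed at nonzero speed, and the sign of the value tells in which of the two possible ways (for
a quadruple point: on which side of the triple point of any three of the sheets the fourth
passes). -/
noncomputable def crossingSpeed (H : ℝ → F → Space) (t : ℝ) (l : F →₀ Covector) : ℝ :=
  l.sum fun x ν => ν (velocity H t x)

/-- The second derivative of `g` at `x`, in the preferred chart of `F` at `x`. -/
noncomputable def secondDifferential (g : F → Space) (x : F) (v w : Plane) : Space :=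
  fderiv ℝ (fun y => fderiv ℝ (g ∘ (extChartAt (𝓡 2) x).symm) y) (extChartAt (𝓡 2) x x) v w

/-- A choice `v x` of a tangent vector of each of the sheets in the relation `l` that all have
the same image in `ℝ³`, i.e. a vector that is tangent to all the sheets in `l`. -/
def IsCommonTangent (g : F → Space) (l : F →₀ Covector) (v : F → Plane) : Prop :=
  ∃ u : Space, ∀ x ∈ l.support, differential g x (v x) = u

/-- The contact of the sheets in the relation `l` is nondegenerate: the quadratic form
`∑ l x (D²g(x)(v x, v x))`, which is independent of charts as `l x` is a conormal, is nondegenerate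
on the space of common tangent vectors of the sheets. -/
def NondegenerateContact (g : F → Space) (l : F →₀ Covector) : Prop :=
  ∀ v, IsCommonTangent g l v →
    (∀ w, IsCommonTangent g l w →
      (l.sum fun x ν => ν (secondDifferential g x (v x) (w x))) = 0) →
    ∀ x ∈ l.support, v x = 0

/-- At time `t` the homotopy `H` goes transversely through a codimension one stratum of the
discriminant, at the point `p`: the relations of the sheets through `p` form a line, spanned by a
relation in which all sheets through `p` take part, their contact is nondegenerate, and the
crossing speed is not zero. According to the number of sheets the cases are:
two sheets: a nondegenerate (elliptic or hyperbolic) tangency of two sheets;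
three sheets: pairwise transverse sheets such that the intersection curve of any two has a
quadratic tangency with the third;
four sheets: a quadruple point any three of whose sheets are in general position. -/
def IsSimpleCrossing (H : ℝ → F → Space) (t : ℝ) (p : Space) : Prop :=
  ∃ l : F →₀ Covector, IsConormalRelation (H t) p l ∧
    (∀ x, H t x = p → x ∈ l.support) ∧
    (∀ m, IsConormalRelation (H t) p m → ∃ c : ℝ, m = c • l) ∧
    NondegenerateContact (H t) l ∧
    crossingSpeed H t l ≠ 0

/-- A generic regular homotopy: its ends are generic immersions, and at each time there is at most
one unstable point, at which a codimension one stratum is crossed transversely. -/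
def IsGenericRegularHomotopy (H : ℝ → F → Space) : Prop :=
  IsRegularHomotopy H ∧ H 0 ∈ QuadImm F 0 ∧ H 1 ∈ QuadImm F 0 ∧
    ∀ t ∈ Icc (0 : ℝ) 1, (unstablePoints (H t)).Subsingleton ∧
      ∀ p ∈ unstablePoints (H t), IsSimpleCrossing H t p

/-- The homotopy has no quadruple points: no four sheets ever meet. -/
def NoQuadruplePoints (H : ℝ → F → Space) : Prop :=
  ∀ t ∈ Icc (0 : ℝ) 1, ∀ p : Space, (H t ⁻¹' {p}).encard ≤ 3

/-- A `q`-invariant: a `ℤ/2`-valued function on generic immersions that does not change along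
generic regular homotopies with no quadruple points. -/
def IsQInvariant (f : QuadImm F 0 → ZMod 2) : Prop :=
  ∀ H : ℝ → F → Space, IsGenericRegularHomotopy H → NoQuadruplePoints H →
    ∀ (h₀ : H 0 ∈ QuadImm F 0) (h₁ : H 1 ∈ QuadImm F 0), f ⟨H 0, h₀⟩ = f ⟨H 1, h₁⟩

/-! ### Slight deformations and the extension of `q`-invariants -/

/-- `G` is a smooth deformation that starts at `i`. The maps obtained from `i` by deforming it
slightly are the `G s` for small `s > 0`. -/
def IsDeformation (i : F → Space) (G : ℝ → F → Space) : Prop :=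
  IsSmoothHomotopy G ∧ G 0 = i

/-- A deformation of `i` that resolves each of its (generic quadruple) unstable points, to first
order. -/
def IsResolution (i : F → Space) (G : ℝ → F → Space) : Prop :=
  IsDeformation i G ∧ ∀ p ∈ unstablePoints i, ∀ l, IsConormalRelation i p l → l ≠ 0 →
    crossingSpeed G 0 l ≠ 0

/-- The type of all resolutions of `i`. -/
def Resolution (i : F → Space) : Type _ := {G : ℝ → F → Space // IsResolution i G}

/-- Two resolutions are of the same kind if at every unstable point they deform to the same
side. -/
def SameSides (i : F → Space) (G G' : ℝ → F → Space) : Prop :=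
  ∀ p ∈ unstablePoints i, ∀ l, IsConormalRelation i p l → l ≠ 0 →
    0 < crossingSpeed G 0 l * crossingSpeed G' 0 l

/-- Resolutions up to being of the same kind. -/
def resolutionSetoid (i : F → Space) : Setoid (Resolution i) where
  r G G' := SameSides i G.1 G'.1
  iseqv :=
    { refl := fun G p hp l hl h0 => mul_self_pos.mpr (G.2.2 p hp l hl h0)
      symm := fun h p hp l hl h0 => by
        rw [mul_comm]
        exact h p hp l hl h0
      trans := fun {G G' G''} h h' p hp l hl h0 => by
        have h1 := h p hp l hl h0
        have h2 := h' p hp l hl h0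
        have h3 : 0 < (crossingSpeed G.1 0 l * crossingSpeed G''.1 0 l) *
            (crossingSpeed G'.1 0 l * crossingSpeed G'.1 0 l) := by
          have := mul_pos h1 h2
          linarith [this]
        exact pos_of_mul_pos_left h3 (mul_self_nonneg _) }

/-- The kinds of resolutions of `i`, one for each of the `2 ^ n` generic immersions that may be
obtained by slightly deforming `i ∈ QuadImm F n`. -/
def ResolutionKind (i : F → Space) : Type _ := Quotient (resolutionSetoid i)

/-- The kind of a resolution. -/
def Resolution.kind {i : F → Space} (G : Resolution i) : ResolutionKind i :=
  Quotient.mk (resolutionSetoid i) G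

/-- The value at `i ∈ QuadImm F n` of the extension of the `q`-invariant `f` is well defined and
equal to `c`: there are `2 ^ n` kinds of resolutions of `i`; the maps obtained by a sufficiently
slight deformation of a given kind are generic immersions at which `f` has one and the same value;
and the sum of these `2 ^ n` values is `c`. -/
def HasExtensionValue (f : QuadImm F 0 → ZMod 2) (i : F → Space) (c : ZMod 2) : Prop :=
  ∃ n : ℕ, i ∈ QuadImm F n ∧ Nat.card (ResolutionKind i) = 2 ^ n ∧
    ∃ v : ResolutionKind i → ZMod 2,
      (∀ G : Resolution i, ∀ᶠ s in 𝓝[>] (0 : ℝ), ∃ h : G.1 s ∈ QuadImm F 0,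
        f ⟨G.1 s, h⟩ = v G.kind) ∧
      ∑ᶠ τ, v τ = c

/-- `G` pushes the sheet of `i` at `x` off the point `i x`: the velocity at `x` is transverse to
the sheet, and all other sheets of `i` that pass through unstable points stay fixed near these
points. The maps obtained from `i` by slightly pushing the sheet are the `G s` for small
`s > 0`. -/
def PushesSheet (i : F → Space) (x : F) (G : ℝ → F → Space) : Prop :=
  IsDeformation i G ∧ velocity G 0 x ∉ sheetPlane i x ∧
    ∀ y, y ≠ x → i y ∈ unstablePoints i → ∀ᶠ z in 𝓝 y, ∀ s ∈ Icc (0 : ℝ) 1, G s z = i z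

/-- `G` and `G'` push the sheet of `i` at `x` to opposite sides. -/
def PushesToOppositeSides (i : F → Space) (x : F) (G G' : ℝ → F → Space) : Prop :=
  ∀ ν : Covector, IsConormal i x ν → ν ≠ 0 → ν (velocity G 0 x) * ν (velocity G' 0 x) < 0

end Immersions

/-! Scale the conormals of the five sheets at `p` to covectors `ν k` whose relations are spanned by
`∑ ν k = 0` and `∑ m k • ν k = 0`. A relation involving at most three sheets is trivial, which
forces the `m k` to be distinct (`exists_quintuple_conormals`). If sheet `k` is displaced with
normal component `ρ k`, then up to a translation of space the displaced configuration is, to first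
order, the point `(A, B) = (∑ ρ k, ∑ m k * ρ k)` of a plane. The four sheets other than sheet `a`
keep a common point to first order exactly when `B = m a * A`. These are five distinct lines through
the origin, the walls, and they cut the plane into ten sectors.

Pushing sheet `k` alone moves along a ray of direction `e * (1, m k)`, which lies in the wall `k`;
pushes to opposite sides give opposite rays. So the ten pushed maps correspond to the ten rays.
Resolving the remaining quadruple point at `p` means stepping off the ray into one of the two
adjacent sectors. A `q`-invariant is constant on each sector, once sides are fixed at the other
quadruple points. Each sector borders two rays, so in the sum over all rays every value occurs twice
and the total vanishes in `ZMod 2` (`sum_wallSide_eq_zero`). This is done for each choice of sides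
at the other quadruple points separately.

The analytic content is `eventually_segment_mem_quadImm`: the straight segment between two slight
deformations lying on the same sides of all walls consists of generic immersions. By compactness,
quadruple points of a map that is `C¹`-close to `i` lie near those of `i`. A first order estimate
shows that such a point can persist only if the corresponding conormal relation nearly vanishes on
the displacement. Sides of walls are half-spaces, so they are preserved along segments. Only linear
homotopies without any unstable point are therefore needed. A variant whose starting point lies in a
wall identifies the resolutions of a pushed map with displacements into the adjacent sectors
(`PushesSheet.eventually_hasExtensionValue`). -/

/-! ### Normal vectors and general position. -/

section Normals

/-- The cross product of the images of the standard basis under `L`. -/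
noncomputable def crossNormal (L : Plane →L[ℝ] Space) : Space :=
  WithLp.toLp 2 (crossProduct (WithLp.ofLp (L (EuclideanSpace.single 0 1)))
    (WithLp.ofLp (L (EuclideanSpace.single 1 1))))

/-- An explicit normal that is continuous in the differential makes general position an open
condition; see `ConvergesC1.eventually_sheetsGeneric`. -/
theorem continuous_crossNormal : Continuous crossNormal := by
  unfold crossNormal
  refine (PiLp.continuous_toLp 2 _).comp ?_
  have h : ∀ (e : Plane) (k : Fin 3), Continuous fun L : Plane →L[ℝ] Space => (L e) k := by
    intro e k
    fun_prop
  refine continuous_pi fun k => ?_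
  simp only [cross_apply]
  fin_cases k <;> simp <;> fun_prop

theorem plane_eq (v : Plane) :
    v = v 0 • EuclideanSpace.single 0 (1 : ℝ) + v 1 • EuclideanSpace.single 1 (1 : ℝ) := by
  ext k
  fin_cases k <;> simp

theorem inner_crossNormal (L : Plane →L[ℝ] Space) (v : Plane) :
    inner ℝ (crossNormal L) (L v) = 0 := by
  rw [plane_eq v, map_add, map_smul, map_smul, inner_add_right, inner_smul_right, inner_smul_right]
  have h0 : inner ℝ (crossNormal L) (L (EuclideanSpace.single 0 1)) = 0 := by
    simp only [EuclideanSpace.inner_eq_star_dotProduct, crossNormal, star_trivial]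
    exact dot_self_cross _ _
  have h1 : inner ℝ (crossNormal L) (L (EuclideanSpace.single 1 1)) = 0 := by
    simp only [EuclideanSpace.inner_eq_star_dotProduct, crossNormal, star_trivial]
    exact dot_cross_self _ _
  rw [h0, h1]; simp

theorem crossNormal_ne_zero {L : Plane →L[ℝ] Space} (hL : Function.Injective L) :
    crossNormal L ≠ 0 := by
  intro h
  have h' : crossProduct (WithLp.ofLp (L (EuclideanSpace.single 0 1)))
      (WithLp.ofLp (L (EuclideanSpace.single 1 1))) = 0 := congrArg WithLp.ofLp h
  refine (crossProduct_ne_zero_iff_linearIndependent.mpr ?_) h'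
  rw [LinearIndependent.pair_iff]
  intro s t hst
  have h2 : L (s • EuclideanSpace.single 0 (1 : ℝ) + t • EuclideanSpace.single 1 (1 : ℝ)) = 0 := by
    rw [map_add, map_smul, map_smul]
    exact WithLp.ofLp_injective 2 hst
  have h3 := hL (h2.trans (map_zero L).symm)
  have e0 := congrArg (fun v : Plane => v 0) h3
  have e1 := congrArg (fun v : Plane => v 1) h3
  simp at e0 e1
  exact ⟨e0, e1⟩

theorem range_eq_orthogonal_crossNormal {L : Plane →L[ℝ] Space} (hL : Function.Injective L) :
    LinearMap.range L.toLinearMap = (Submodule.span ℝ {crossNormal L})ᗮ := by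
  have : Fact (Module.finrank ℝ Space = 2 + 1) := ⟨by simp⟩
  refine Submodule.eq_of_le_of_finrank_eq ?_ ?_
  · rintro _ ⟨v, rfl⟩
    rw [Submodule.mem_orthogonal_singleton_iff_inner_right]
    exact inner_crossNormal L v
  · rw [Submodule.finrank_orthogonal_span_singleton (n := 2) (crossNormal_ne_zero hL),
      LinearMap.finrank_range_of_inj hL]
    simp

end Normals

section GeneralPosition

variable {F : Type*} [TopologicalSpace F] [ChartedSpace Plane F]

/-- The intersection of the planes is the orthogonal complement of the span of the normals, so its
codimension is the rank of the normals. -/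
theorem inGeneralPosition_iff {g : F → Space} {n : F → Space}
    (A : Finset F) (hn : ∀ x ∈ A, sheetPlane g x = (Submodule.span ℝ {n x})ᗮ) :
    InGeneralPosition g A ↔ LinearIndependent ℝ (fun x : A => n x) := by
  have h1 : (⨅ x ∈ A, sheetPlane g x : Submodule ℝ Space) =
      (Submodule.span ℝ (Set.range fun x : A => n x))ᗮ := by
    rw [iInf_subtype', ← Set.iUnion_singleton_eq_range, Submodule.span_iUnion,
      ← Submodule.iInf_orthogonal]
    exact iInf_congr fun x => hn x x.2
  have h2 := Submodule.finrank_add_finrank_orthogonal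
    (Submodule.span ℝ (Set.range fun x : A => n x))
  have h3 : Module.finrank ℝ Space = 3 := by simp
  rw [InGeneralPosition, h1, linearIndependent_iff_card_eq_finrank_span, Set.finrank,
    Fintype.card_coe]
  omega

/-- A normal vector of the sheet of `g` at `x`. -/
noncomputable def sheetNormal (g : F → Space) (x : F) : Space := crossNormal (differential g x)

theorem sheetPlane_eq_orthogonal {g : F → Space} {x : F}
    (hg : Function.Injective (differential g x)) :
    sheetPlane g x = (Submodule.span ℝ {sheetNormal g x})ᗮ :=
  range_eq_orthogonal_crossNormal hg

theorem isConormal_sheetNormal (g : F → Space) (x : F) :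
    IsConormal g x (innerSL ℝ (sheetNormal g x)) := fun v => inner_crossNormal _ v

theorem IsConormal.zero (g : F → Space) (x : F) : IsConormal g x 0 := fun _ => rfl

theorem IsConormal.add {g : F → Space} {x : F} {ν μ : Covector} (h : IsConormal g x ν)
    (h' : IsConormal g x μ) : IsConormal g x (ν + μ) := fun v => by
  rw [add_apply, h v, h' v, add_zero]

theorem IsConormal.smul {g : F → Space} {x : F} {ν : Covector} (h : IsConormal g x ν)
    (c : ℝ) : IsConormal g x (c • ν) := fun v => by
  rw [smul_apply, h v, smul_zero]

theorem IsConormal.exists_smul_sheetNormal {g : F → Space} {x : F}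
    (hg : Function.Injective (differential g x)) {ν : Covector} (h : IsConormal g x ν) :
    ∃ c : ℝ, ν = c • innerSL ℝ (sheetNormal g x) := by
  set w : Space := (InnerProductSpace.toDual ℝ Space).symm ν with hw
  have hν : ν = innerSL ℝ w := by
    ext v
    simp [hw]
  have hw' : w ∈ Submodule.span ℝ {sheetNormal g x} := by
    rw [← Submodule.orthogonal_orthogonal (Submodule.span ℝ {sheetNormal g x}),
      ← sheetPlane_eq_orthogonal hg, Submodule.mem_orthogonal]
    rintro _ ⟨v, rfl⟩
    have := h v
    rw [hν, innerSL_apply_apply] at this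
    rw [real_inner_comm]
    exact this
  obtain ⟨c, hc⟩ := Submodule.mem_span_singleton.mp hw'
  exact ⟨c, by rw [hν, ← hc, map_smul]⟩

theorem IsConormal.exists_smul {g : F → Space} {x : F}
    (hg : Function.Injective (differential g x)) {ν μ : Covector} (h : IsConormal g x ν)
    (hν : ν ≠ 0) (h' : IsConormal g x μ) : ∃ c : ℝ, μ = c • ν := by
  obtain ⟨a, ha⟩ := h.exists_smul_sheetNormal hg
  obtain ⟨b, hb⟩ := h'.exists_smul_sheetNormal hg
  have ha0 : a ≠ 0 := by
    rintro rfl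
    exact hν (by rw [ha, zero_smul])
  exact ⟨b / a, by rw [hb, ha, smul_smul, div_mul_cancel₀ _ ha0]⟩

theorem IsConormal.mem_sheetPlane {g : F → Space} {x : F}
    (hg : Function.Injective (differential g x)) {ν : Covector} (h : IsConormal g x ν)
    (hν : ν ≠ 0) {w : Space} (hw : ν w = 0) : w ∈ sheetPlane g x := by
  rw [sheetPlane_eq_orthogonal hg, Submodule.mem_orthogonal_singleton_iff_inner_right]
  obtain ⟨a, ha⟩ := h.exists_smul_sheetNormal hg
  rw [ha, smul_apply, innerSL_apply_apply, smul_eq_mul] at hw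
  refine (mul_eq_zero.mp hw).resolve_left ?_
  rintro rfl
  exact hν (by rw [ha, zero_smul])

theorem InGeneralPosition.eq_zero_of_sum_eq_zero {g : F → Space}
    (hg : ∀ x, Function.Injective (differential g x)) {A : Finset F} (hA : InGeneralPosition g A)
    {ν : F → Covector} (hν : ∀ x, IsConormal g x (ν x)) (hsum : ∑ x ∈ A, ν x = 0) :
    ∀ x ∈ A, ν x = 0 := by
  choose c hc using fun x => (hν x).exists_smul_sheetNormal (hg x)
  have hli := (inGeneralPosition_iff A fun x _ => sheetPlane_eq_orthogonal (hg x)).mp hA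
  have h0 : ∑ x ∈ A, c x • sheetNormal g x = 0 := by
    have : innerSL ℝ (∑ x ∈ A, c x • sheetNormal g x) = 0 := by
      rw [map_sum, ← hsum]
      exact Finset.sum_congr rfl fun x _ => by rw [map_smul, ← hc x]
    have h1 := congrArg (fun φ : Covector => φ (∑ x ∈ A, c x • sheetNormal g x)) this
    rwa [innerSL_apply_apply, zero_apply, inner_self_eq_zero] at h1
  have h1 := Fintype.linearIndependent_iff.mp hli (fun x => c x)
    (by rw [← h0]; exact Finset.sum_coe_sort A fun x => c x • sheetNormal g x)
  intro x hx
  rw [hc x, h1 ⟨x, hx⟩, zero_smul]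

theorem InGeneralPosition.eq_zero_of_forall {g : F → Space}
    (hg : ∀ x, Function.Injective (differential g x)) {A : Finset F} (hA : InGeneralPosition g A)
    (hcard : A.card = 3) {ν : F → Covector} (hν : ∀ x ∈ A, IsConormal g x (ν x))
    (hne : ∀ x ∈ A, ν x ≠ 0) {w : Space} (hw : ∀ x ∈ A, ν x w = 0) : w = 0 := by
  have h1 : (⨅ x ∈ A, sheetPlane g x : Submodule ℝ Space) = ⊥ := by
    rw [InGeneralPosition, hcard] at hA
    exact Submodule.finrank_eq_zero.mp (by omega)
  have : w ∈ (⨅ x ∈ A, sheetPlane g x : Submodule ℝ Space) := by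
    simp only [Submodule.mem_iInf]
    exact fun x hx => (hν x hx).mem_sheetPlane (hg x) (hne x hx) (hw x hx)
  rwa [h1, Submodule.mem_bot] at this

end GeneralPosition

/-! ### Linear relations among conormals. -/

section CovectorFamilies

variable {F : Type*}

theorem crossingSpeed_smul (H : ℝ → F → Space) (t c : ℝ) (l : F →₀ Covector) :
    crossingSpeed H t (c • l) = c * crossingSpeed H t l := by
  rw [crossingSpeed, Finsupp.sum_smul_index' (fun _ => rfl), crossingSpeed, Finsupp.sum,
    Finsupp.sum, Finset.mul_sum]
  rfl

/-- The family of conormals `ν k` at the points `x k`. -/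
noncomputable def conormalFamily {ι : Type*} [Finite ι] {x : ι → F} (hx : Function.Injective x)
    (ν : ι → Covector) : F →₀ Covector :=
  Finsupp.embDomain ⟨x, hx⟩ (Finsupp.equivFunOnFinite.symm ν)

theorem conormalFamily_apply {ι : Type*} [Finite ι] {x : ι → F} (hx : Function.Injective x)
    (ν : ι → Covector) (k : ι) : conormalFamily hx ν (x k) = ν k :=
  Finsupp.embDomain_apply_self ⟨x, hx⟩ _ k

theorem mem_support_conormalFamily {ι : Type*} [Finite ι] {x : ι → F} (hx : Function.Injective x)
    (ν : ι → Covector) (y : F) :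
    y ∈ (conormalFamily hx ν).support ↔ ∃ k, ν k ≠ 0 ∧ x k = y := by
  rw [conormalFamily, Finsupp.support_embDomain, Finset.mem_map]
  simp

theorem sum_conormalFamily {ι M : Type*} [Fintype ι] [AddCommMonoid M] {x : ι → F}
    (hx : Function.Injective x) (ν : ι → Covector) (φ : F → Covector → M) (hφ : ∀ y, φ y 0 = 0) :
    (conormalFamily hx ν).sum φ = ∑ k, φ (x k) (ν k) := by
  rw [conormalFamily, Finsupp.sum_embDomain, Finsupp.sum_fintype _ _ (fun i => hφ _)]
  rfl

theorem crossingSpeed_conormalFamily {ι : Type*} [Fintype ι] {x : ι → F}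
    (hx : Function.Injective x) (ν : ι → Covector) (H : ℝ → F → Space) (t : ℝ) :
    crossingSpeed H t (conormalFamily hx ν) = ∑ k, ν k (velocity H t (x k)) :=
  sum_conormalFamily hx ν _ (fun _ => rfl)

end CovectorFamilies

section Relations

variable {F : Type*} [TopologicalSpace F] [ChartedSpace Plane F]

theorem IsConormalRelation.smul {g : F → Space} {p : Space} {l : F →₀ Covector}
    (h : IsConormalRelation g p l) (c : ℝ) : IsConormalRelation g p (c • l) where
  mem_fiber x hx := h.mem_fiber x (Finsupp.support_smul hx)
  conormal x := (h.conormal x).smul c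
  sum_eq_zero := by
    rw [Finsupp.sum_smul_index' (fun _ => rfl), ← Finsupp.smul_sum, h.sum_eq_zero, smul_zero]

theorem IsConormalRelation.add {g : F → Space} {p : Space} {l l' : F →₀ Covector}
    (h : IsConormalRelation g p l) (h' : IsConormalRelation g p l') :
    IsConormalRelation g p (l + l') where
  mem_fiber x hx := by
    classical
    rcases Finset.mem_union.mp (Finsupp.support_add hx) with hx | hx
    · exact h.mem_fiber x hx
    · exact h'.mem_fiber x hx
  conormal x := (h.conormal x).add (h'.conormal x)
  sum_eq_zero := by
    classical
    rw [Finsupp.sum_add_index' (fun _ => rfl) (fun _ _ _ => rfl), h.sum_eq_zero, h'.sum_eq_zero,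
      add_zero]

theorem IsConormalRelation.eq_zero_of_card_le {g : F → Space}
    (hg : ∀ x, Function.Injective (differential g x)) {p : Space} (hp : SheetsGeneric g p)
    {l : F →₀ Covector} (h : IsConormalRelation g p l) (hcard : l.support.card ≤ 3) : l = 0 := by
  have h1 := (hp l.support h.mem_fiber hcard).eq_zero_of_sum_eq_zero hg h.conormal h.sum_eq_zero
  ext1 x
  by_cases hx : x ∈ l.support
  · exact h1 x hx
  · simpa using hx

/-- Subtracting the multiple of `l` that cancels the coefficient at one sheet leaves a relation
among three sheets, which is zero. -/
theorem IsConormalRelation.exists_smul_eq {g : F → Space}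
    (hg : ∀ x, Function.Injective (differential g x)) {p : Space} (hp : SheetsGeneric g p)
    {l l' : F →₀ Covector} (h : IsConormalRelation g p l) (h' : IsConormalRelation g p l')
    (hl : l ≠ 0) {A : Finset F} (hA : A.card = 4) (hlA : l.support ⊆ A) (hlA' : l'.support ⊆ A) :
    ∃ c : ℝ, l' = c • l := by
  classical
  obtain ⟨x, hx⟩ := Finsupp.support_nonempty_iff.mpr hl
  obtain ⟨c, hc⟩ := (h.conormal x).exists_smul (hg x) (Finsupp.mem_support_iff.mp hx)
    (h'.conormal x)
  refine ⟨c, ?_⟩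
  have h0 := (h'.add (h.smul (-c))).eq_zero_of_card_le hg hp (by
    have : (l' + -c • l).support ⊆ A.erase x := by
      intro y hy
      refine Finset.mem_erase.mpr ⟨?_, ?_⟩
      · rintro rfl
        refine Finsupp.mem_support_iff.mp hy ?_
        rw [Finsupp.add_apply, Finsupp.smul_apply, hc, neg_smul, add_neg_cancel]
      · rcases Finset.mem_union.mp (Finsupp.support_add hy) with hy | hy
        · exact hlA' hy
        · exact hlA (Finsupp.support_smul hy)
    calc _ ≤ (A.erase x).card := Finset.card_le_card this
      _ ≤ 3 := by rw [Finset.card_erase_of_mem (hlA hx), hA])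
  calc l' = (l' + -c • l) + c • l := by module
    _ = c • l := by rw [h0, zero_add]

/-- Four normals in three dimensions are dependent, and a nonzero relation cannot omit any of the
four, since three are independent. -/
theorem exists_isConormalRelation_support_eq {g : F → Space}
    (hg : ∀ x, Function.Injective (differential g x)) {p : Space} (hp : SheetsGeneric g p)
    {A : Finset F} (hA : A.card = 4) (hAp : ∀ x ∈ A, g x = p) :
    ∃ l : F →₀ Covector, IsConormalRelation g p l ∧ l.support = A := by
  classical
  have hdep : ¬ LinearIndependent ℝ (fun x : A => sheetNormal g x) := by
    intro h
    have := h.fintype_card_le_finrank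
    rw [Fintype.card_coe, hA] at this
    simp at this
  rw [Fintype.not_linearIndependent_iff] at hdep
  obtain ⟨c, hc, ⟨y, hy⟩⟩ := hdep
  let ν : F → Covector := fun x => if hx : x ∈ A then c ⟨x, hx⟩ • innerSL ℝ (sheetNormal g x) else 0
  have hν : ∀ x, IsConormal g x (ν x) := by
    intro x
    by_cases hx : x ∈ A
    · simp only [ν, hx, dif_pos]
      exact (isConormal_sheetNormal g x).smul _
    · simp only [ν, hx, dif_neg, not_false_iff]
      exact IsConormal.zero g x
  let l : F →₀ Covector := Finsupp.onFinset A ν (fun x hx => by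
    by_contra h
    exact hx (by simp only [ν, h, dif_neg, not_false_iff]))
  have hsub : l.support ⊆ A := Finsupp.support_onFinset_subset
  have hl : IsConormalRelation g p l := by
    refine ⟨fun x hx => hAp x (hsub hx), hν, ?_⟩
    rw [Finsupp.sum_of_support_subset l hsub _ (fun _ _ => rfl)]
    have : ∑ x : A, c x • innerSL ℝ (sheetNormal g x) = 0 := by
      have := congrArg (innerSL ℝ) hc
      rw [map_sum, map_zero] at this
      rw [← this]
      exact Finset.sum_congr rfl fun x _ => (map_smul _ _ _).symm
    rw [← this, ← Finset.sum_coe_sort]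
    refine Finset.sum_congr rfl fun x _ => ?_
    simp [l, ν]
  have hl0 : l ≠ 0 := by
    intro h
    have h1 : ν y = 0 := DFunLike.congr_fun h (y : F)
    simp only [ν, y.2, dif_pos, Subtype.coe_eta] at h1
    rcases smul_eq_zero.mp h1 with h1 | h1
    · exact hy h1
    · have h2 := congrArg (fun φ : Covector => φ (sheetNormal g y)) h1
      simp only [innerSL_apply_apply, zero_apply, inner_self_eq_zero] at h2
      exact crossNormal_ne_zero (hg y) h2
  refine ⟨l, hl, Finset.eq_of_subset_of_card_le hsub ?_⟩
  by_contra hlt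
  exact hl0 (hl.eq_zero_of_card_le hg hp (by omega))

end Relations

/-! ### The pencil of relations at a quintuple point. -/

section Quintuple

variable {F : Type*} [TopologicalSpace F] [ChartedSpace Plane F]

theorem isConormalRelation_conormalFamily {ι : Type*} [Fintype ι] {g : F → Space} {p : Space}
    {x : ι → F} (hx : Function.Injective x) {ν : ι → Covector} (hxp : ∀ k, g (x k) = p)
    (hν : ∀ k, IsConormal g (x k) (ν k)) (hsum : ∑ k, ν k = 0) :
    IsConormalRelation g p (conormalFamily hx ν) where
  mem_fiber y hy := by
    obtain ⟨k, -, rfl⟩ := (mem_support_conormalFamily hx ν y).mp hy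
    exact hxp k
  conormal y := by
    by_cases hy : y ∈ (conormalFamily hx ν).support
    · obtain ⟨k, -, rfl⟩ := (mem_support_conormalFamily hx ν y).mp hy
      rw [conormalFamily_apply]
      exact hν k
    · rw [Finsupp.notMem_support_iff.mp hy]
      exact IsConormal.zero g y
  sum_eq_zero := by rw [sum_conormalFamily hx ν _ (fun _ => rfl), hsum]

/-- The conormals of the five sheets at a generic quintuple point can be scaled so that the
relations among them are spanned by `∑ ν k = 0` and `∑ m k • ν k = 0` with distinct `m k`. -/
theorem exists_quintuple_conormals {g : F → Space}
    (hg : ∀ x, Function.Injective (differential g x)) {p : Space} (hp : SheetsGeneric g p)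
    {x : Fin 5 → F} (hx : Function.Injective x) (hxp : ∀ k, g (x k) = p) :
    ∃ (ν : Fin 5 → Covector) (m : Fin 5 → ℝ), Function.Injective m ∧
      (∀ k, IsConormal g (x k) (ν k)) ∧ (∀ k, ν k ≠ 0) ∧ ∑ k, ν k = 0 ∧
      ∑ k, m k • ν k = 0 := by
  classical
  have hrel : ∀ a : Fin 5, ∃ ν : Fin 5 → Covector, (∀ k, IsConormal g (x k) (ν k)) ∧
      ∑ k, ν k = 0 ∧ ∀ k, ν k = 0 ↔ k = a := by
    intro a
    obtain ⟨l, hl, hs⟩ := exists_isConormalRelation_support_eq hg hp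
      (A := (Finset.univ.erase a).map ⟨x, hx⟩) (by simp) (by
        intro y hy
        obtain ⟨k, -, rfl⟩ := Finset.mem_map.mp hy
        exact hxp k)
    refine ⟨fun k => l (x k), fun k => hl.conormal _, ?_, ?_⟩
    · have h1 := hl.sum_eq_zero
      rw [Finsupp.sum_of_support_subset l (s := Finset.univ.map ⟨x, hx⟩) (by
        rw [hs]; exact Finset.map_subset_map.mpr (Finset.subset_univ _)) _ (fun _ _ => rfl),
        Finset.sum_map] at h1
      exact h1
    · intro k
      rw [← Finsupp.notMem_support_iff, hs]
      simp [hx.eq_iff]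
  -- A relation that omits two of the five sheets involves at most three, hence is trivial.
  have hzero : ∀ ν : Fin 5 → Covector, (∀ k, IsConormal g (x k) (ν k)) → ∑ k, ν k = 0 →
      ∀ a b, a ≠ b → ν a = 0 → ν b = 0 → ∀ k, ν k = 0 := by
    intro ν hν hsum a b hab ha hb k
    have h0 := (isConormalRelation_conormalFamily hx hxp hν hsum).eq_zero_of_card_le hg hp (by
      have : (conormalFamily hx ν).support ⊆ ((Finset.univ.erase a).erase b).map ⟨x, hx⟩ := by
        intro y hy
        obtain ⟨k, hk, rfl⟩ := (mem_support_conormalFamily hx ν y).mp hy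
        simp only [Finset.mem_map, Finset.mem_erase]
        exact ⟨k, ⟨fun h => hk (h ▸ hb), fun h => hk (h ▸ ha), Finset.mem_univ k⟩, rfl⟩
      calc _ ≤ _ := Finset.card_le_card this
        _ ≤ 3 := by
          rw [Finset.card_map, Finset.card_erase_of_mem (by simp [hab.symm]),
            Finset.card_erase_of_mem (Finset.mem_univ _)]
          simp)
    rw [← conormalFamily_apply hx ν k, h0, Finsupp.zero_apply]
  obtain ⟨α, hα, hαs, hα0⟩ := hrel 0
  obtain ⟨β, hβ, hβs, hβ0⟩ := hrel 1
  -- `α` omits only sheet 0 and `β` only sheet 1, so each `k` excludes at most one `t`. The general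
  -- member `α + t • β` of the pencil then involves all five sheets and serves as `ν`, with `α k = m
  -- k • ν k`.
  obtain ⟨t, ht⟩ : ∃ t : ℝ, ∀ k, α k + t • β k ≠ 0 := by
    have hfin : (⋃ k : Fin 5, {t : ℝ | α k + t • β k = 0}).Finite := by
      refine Set.finite_iUnion fun k => Set.Subsingleton.finite ?_
      intro s hs t ht
      have hst : (s - t) • β k = 0 := by
        have : (α k + s • β k) - (α k + t • β k) = 0 := by rw [hs, ht, sub_zero]
        rw [← this]; module
      rcases smul_eq_zero.mp hst with h | h
      · linarith
      · have hk := (hβ0 k).mp h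
        have : α k = 0 := by
          have := hs
          rw [mem_ofPred_eq, h, smul_zero, add_zero] at this
          exact this
        rw [hα0] at this
        rw [this] at hk
        exact absurd hk (by decide)
    obtain ⟨t, ht⟩ := hfin.exists_notMem
    simp only [mem_iUnion, mem_ofPred_eq, not_exists] at ht
    exact ⟨t, ht⟩
  have hν : ∀ k, IsConormal g (x k) (α k + t • β k) := fun k => (hα k).add ((hβ k).smul t)
  choose m hm using fun k => (hν k).exists_smul (hg _) (ht k) (hα k)
  have hm0 : ∀ k, m k = 0 ↔ k = 0 := by
    intro k
    rw [← hα0 k, hm k, smul_eq_zero, or_iff_left (ht k)]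
  have hm1 : m 1 = 1 := by
    have h1 := hm 1
    have hb : β 1 = 0 := (hβ0 1).mpr rfl
    have ha : α 1 ≠ 0 := fun h => absurd ((hα0 1).mp h) (by decide)
    rw [hb, smul_zero, add_zero] at h1
    have : (m 1 - 1) • α 1 = 0 := by
      calc (m 1 - 1) • α 1 = m 1 • α 1 - α 1 := by module
        _ = 0 := sub_eq_zero.mpr h1.symm
    rcases smul_eq_zero.mp this with h | h
    · linarith
    · exact absurd h ha
  have hsum : ∑ k, (α k + t • β k) = 0 := by
    rw [Finset.sum_add_distrib, ← Finset.smul_sum, hαs, hβs, smul_zero, add_zero]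
  refine ⟨fun k => α k + t • β k, m, ?_, hν, ht, hsum, ?_⟩
  -- If `m a = m b`, then the relation `α - m a • ν` omits both `a` and `b`, so it is zero and `m`
  -- is constant. This contradicts `m 0 = 0` and `m 1 = 1`.
  · intro a b hab
    by_contra hne
    have h0 := hzero (fun k => α k - m a • (α k + t • β k))
      (fun k => by
        have := (hα k).add ((hν k).smul (-m a))
        convert this using 1
        module)
      (by rw [Finset.sum_sub_distrib, ← Finset.smul_sum, hαs, hsum, smul_zero, sub_zero])
      a b hne (sub_eq_zero.mpr (hm a)) (by rw [hab]; exact sub_eq_zero.mpr (hm b))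
    have hmk : ∀ k, m k = m a := by
      intro k
      have h1 : (m k - m a) • (α k + t • β k) = 0 := by
        calc (m k - m a) • (α k + t • β k)
            = m k • (α k + t • β k) - m a • (α k + t • β k) := by module
          _ = 0 := by rw [← hm k]; exact h0 k
      exact sub_eq_zero.mp ((smul_eq_zero.mp h1).resolve_right (ht k))
    have e0 := hmk 0
    rw [(hm0 0).mpr rfl, ← hmk 1, hm1] at e0
    norm_num at e0
  · rw [← hαs]
    exact Finset.sum_congr rfl fun k _ => (hm k).symm

end Quintuple

/-! ### `C¹` convergence and stability of multiple points. -/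

section C1Convergence

variable {F : Type*} [TopologicalSpace F] [ChartedSpace Plane F]

/-- The smooth map `h` is `ε`-close to `i` in the `C¹` sense, the differentials being measured in
the metric induced by `i`. -/
structure C1Close (i : F → Space) (ε : ℝ) (h : F → Space) : Prop where
  smooth : ContMDiff (𝓡 2) 𝓘(ℝ, Space) ∞ h
  norm_sub_le : ∀ y, ‖h y - i y‖ ≤ ε
  norm_differential_sub_le : ∀ y v,
    ‖differential h y v - differential i y v‖ ≤ ε * ‖differential i y v‖

/-- The family `h` of smooth maps converges to `i` along the filter `𝓕` in the `C¹` sense. -/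
def ConvergesC1 {T : Type*} (𝓕 : Filter T) (h : T → F → Space) (i : F → Space) : Prop :=
  ∀ ε : ℝ, 0 < ε → ∀ᶠ t in 𝓕, C1Close i ε (h t)

/-- The map `h` in the preferred chart at `x`. -/
noncomputable def chartRep (h : F → Space) (x : F) : Plane → Space :=
  h ∘ (extChartAt (𝓡 2) x).symm

theorem chartRep_extChartAt (h : F → Space) {x y : F} (hy : y ∈ (extChartAt (𝓡 2) x).source) :
    chartRep h x (extChartAt (𝓡 2) x y) = h y := by
  rw [chartRep, Function.comp_apply, (extChartAt (𝓡 2) x).left_inv hy]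

theorem C1Close.injective_differential {i h : F → Space} {ε : ℝ} (hε : ε < 1)
    (hi : IsSurfaceImmersion i) (hh : C1Close i ε h) (y : F) :
    Function.Injective (differential h y) := by
  rw [injective_iff_map_eq_zero]
  intro v hv
  have h1 := hh.norm_differential_sub_le y v
  rw [hv, zero_sub, norm_neg] at h1
  have h2 : ‖differential i y v‖ = 0 := by nlinarith [norm_nonneg (differential i y v)]
  exact (injective_iff_map_eq_zero _).mp (hi.2 y) v (norm_eq_zero.mp h2)

theorem ConvergesC1.tendsto_apply {T : Type*} {𝓕 : Filter T} {h : T → F → Space}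
    {i : F → Space} (hi : Continuous i) (hh : ConvergesC1 𝓕 h i) (x : F) :
    Tendsto (fun z : T × F => h z.1 z.2) (𝓕 ×ˢ 𝓝 x) (𝓝 (i x)) := by
  have hmain : Tendsto (fun z : T × F => h z.1 z.2 - i z.2) (𝓕 ×ˢ 𝓝 x) (𝓝 0) := by
    rw [Metric.tendsto_nhds]
    intro ε hε
    filter_upwards [tendsto_fst.eventually (hh (ε / 2) (by positivity))] with z hz
    rw [dist_zero_right]
    linarith [hz.norm_sub_le z.2]
  have := hmain.add (hi.continuousAt.tendsto.comp (tendsto_snd (f := 𝓕) (g := 𝓝 x)))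
  simpa using this

theorem ConvergesC1.eventually_isSurfaceImmersion {T : Type*} {𝓕 : Filter T}
    {h : T → F → Space} {i : F → Space} (hi : IsSurfaceImmersion i) (hh : ConvergesC1 𝓕 h i) :
    ∀ᶠ t in 𝓕, IsSurfaceImmersion (h t) := by
  filter_upwards [hh (1 / 2) (by norm_num)] with t ht
  exact ⟨ht.smooth, ht.injective_differential (by norm_num) hi⟩

variable [IsManifold (𝓡 2) ∞ F]

theorem contDiffOn_chartRep {h : F → Space} (hh : ContMDiff (𝓡 2) 𝓘(ℝ, Space) ∞ h) (x : F) :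
    ContDiffOn ℝ ∞ (chartRep h x) (extChartAt (𝓡 2) x).target := by
  rw [← contMDiffOn_iff_contDiffOn]
  exact hh.comp_contMDiffOn (contMDiffOn_extChartAt_symm x)

theorem differential_eq_comp {h : F → Space} (hh : ContMDiff (𝓡 2) 𝓘(ℝ, Space) ∞ h) {x y : F}
    (hy : y ∈ (extChartAt (𝓡 2) x).source) :
    differential h y = (fderiv ℝ (chartRep h x) (extChartAt (𝓡 2) x y)).comp
      (mfderiv (𝓡 2) 𝓘(ℝ, Plane) (extChartAt (𝓡 2) x) y) := by
  have hd : HasMFDerivAt 𝓘(ℝ, Plane) 𝓘(ℝ, Space) (chartRep h x) (extChartAt (𝓡 2) x y)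
      (fderiv ℝ (chartRep h x) (extChartAt (𝓡 2) x y)) :=
    (((contDiffOn_chartRep hh x).differentiableOn (by simp)).differentiableAt
      ((isOpen_extChartAt_target x).mem_nhds
        ((extChartAt (𝓡 2) x).map_source hy))).hasFDerivAt.hasMFDerivAt
  have hφ : MDifferentiableAt (𝓡 2) 𝓘(ℝ, Plane) (extChartAt (𝓡 2) x) y :=
    mdifferentiableAt_extChartAt (by rwa [extChartAt_source] at hy)
  refine ((hd.comp y hφ.hasMFDerivAt).congr_of_eventuallyEq ?_).mfderiv
  filter_upwards [(isOpen_extChartAt_source x).mem_nhds hy] with z hz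
  exact (chartRep_extChartAt h hz).symm

theorem surjective_mfderiv_extChartAt {x y : F} (hy : y ∈ (extChartAt (𝓡 2) x).source) :
    Function.Surjective (mfderiv (𝓡 2) 𝓘(ℝ, Plane) (extChartAt (𝓡 2) x) y) :=
  (isInvertible_mfderiv_extChartAt hy).bijective.surjective

theorem injective_fderiv_chartRep {h : F → Space} (hh : IsSurfaceImmersion h) {x y : F}
    (hy : y ∈ (extChartAt (𝓡 2) x).source) :
    Function.Injective (fderiv ℝ (chartRep h x) (extChartAt (𝓡 2) x y)) := by
  have h1 := hh.2 y
  rw [differential_eq_comp hh.1 hy] at h1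
  exact Function.Injective.of_comp_right h1 (surjective_mfderiv_extChartAt hy)

theorem sheetPlane_eq_range_chartRep {h : F → Space} (hh : ContMDiff (𝓡 2) 𝓘(ℝ, Space) ∞ h)
    {x y : F} (hy : y ∈ (extChartAt (𝓡 2) x).source) :
    sheetPlane h y =
      LinearMap.range (fderiv ℝ (chartRep h x) (extChartAt (𝓡 2) x y)).toLinearMap := by
  rw [sheetPlane, differential_eq_comp hh hy]
  exact LinearMap.range_comp_of_range_eq_top _
    (LinearMap.range_eq_top.mpr (surjective_mfderiv_extChartAt hy))

theorem IsConormal.apply_fderiv_chartRep {h : F → Space}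
    (hh : ContMDiff (𝓡 2) 𝓘(ℝ, Space) ∞ h) {x : F} {ν : Covector} (hν : IsConormal h x ν)
    (v : Plane) : ν (fderiv ℝ (chartRep h x) (extChartAt (𝓡 2) x x) v) = 0 := by
  have hx := mem_extChartAt_source (I := 𝓡 2) x
  obtain ⟨w, rfl⟩ := surjective_mfderiv_extChartAt hx v
  have := hν w
  rwa [differential_eq_comp hh hx] at this

theorem C1Close.norm_fderiv_chartRep_sub_le {i h : F → Space} {ε : ℝ}
    (hi : ContMDiff (𝓡 2) 𝓘(ℝ, Space) ∞ i) (hh : C1Close i ε h) {x y : F}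
    (hy : y ∈ (extChartAt (𝓡 2) x).source) (v : Plane) :
    ‖fderiv ℝ (chartRep h x) (extChartAt (𝓡 2) x y) v -
      fderiv ℝ (chartRep i x) (extChartAt (𝓡 2) x y) v‖ ≤
      ε * ‖fderiv ℝ (chartRep i x) (extChartAt (𝓡 2) x y) v‖ := by
  obtain ⟨w, rfl⟩ := surjective_mfderiv_extChartAt hy v
  have := hh.norm_differential_sub_le y w
  rwa [differential_eq_comp hh.smooth hy, differential_eq_comp hi hy] at this

/-- The relative bound in `C1Close` becomes an operator norm bound because the differential of `i`
is bounded near the centre of the chart. Convergence is joint in parameter and point, as is needed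
when the points of a tuple move too. -/
theorem ConvergesC1.tendsto_fderiv_chartRep {T : Type*} {𝓕 : Filter T} {h : T → F → Space}
    {i : F → Space} (hi : ContMDiff (𝓡 2) 𝓘(ℝ, Space) ∞ i) (hh : ConvergesC1 𝓕 h i) (x : F) :
    Tendsto (fun z : T × Plane => fderiv ℝ (chartRep (h z.1) x) z.2)
      (𝓕 ×ˢ 𝓝 (extChartAt (𝓡 2) x x))
      (𝓝 (fderiv ℝ (chartRep i x) (extChartAt (𝓡 2) x x))) := by
  set u₀ := extChartAt (𝓡 2) x x with hu₀
  have htarget : (extChartAt (𝓡 2) x).target ∈ 𝓝 u₀ := extChartAt_target_mem_nhds x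
  have hcont : ContinuousAt (fun u => fderiv ℝ (chartRep i x) u) u₀ :=
    (((contDiffOn_chartRep hi x).continuousOn_fderiv_of_isOpen
      (isOpen_extChartAt_target x) (by simp)).continuousAt htarget)
  have hmain : Tendsto (fun z : T × Plane => fderiv ℝ (chartRep (h z.1) x) z.2 -
      fderiv ℝ (chartRep i x) z.2) (𝓕 ×ˢ 𝓝 u₀) (𝓝 0) := by
    rw [Metric.tendsto_nhds]
    intro ε hε
    set K := ‖fderiv ℝ (chartRep i x) u₀‖ + 1 with hK
    have hKpos : 0 < K := by positivity
    have h1 : ∀ᶠ u in 𝓝 u₀, ‖fderiv ℝ (chartRep i x) u‖ < K :=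
      hcont.norm.eventually_lt continuousAt_const (by simp [hK])
    filter_upwards [prod_mem_prod (hh (ε / (2 * K)) (by positivity)) (inter_mem h1 htarget)]
      with ⟨t, u⟩ ⟨ht, hu1, hu2⟩
    rw [dist_zero_right]
    refine lt_of_le_of_lt (ContinuousLinearMap.opNorm_le_bound _ (M := ε / 2) (by positivity) ?_)
      (by linarith)
    intro v
    have h2 := C1Close.norm_fderiv_chartRep_sub_le (x := x) hi ht
      ((extChartAt (𝓡 2) x).map_target hu2) v
    rw [(extChartAt (𝓡 2) x).right_inv hu2] at h2
    calc _ ≤ ε / (2 * K) * ‖fderiv ℝ (chartRep i x) u v‖ := h2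
      _ ≤ ε / (2 * K) * (K * ‖v‖) := by
        gcongr
        exact ContinuousLinearMap.le_of_opNorm_le _ hu1.le v
      _ = ε / 2 * ‖v‖ := by field_simp
  have := hmain.add ((hcont.tendsto).comp (tendsto_snd (f := 𝓕)))
  simpa using this

theorem exists_pos_mul_norm_le {L : Plane →L[ℝ] Space} (hL : Function.Injective L) :
    ∃ c : ℝ, 0 < c ∧ ∀ v, c * ‖v‖ ≤ ‖L v‖ := by
  obtain ⟨K, hK, hKL⟩ := L.toLinearMap.exists_antilipschitzWith (LinearMap.ker_eq_bot.mpr hL)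
  refine ⟨(K : ℝ)⁻¹, by positivity, fun v => ?_⟩
  rw [inv_mul_le_iff₀ (by exact_mod_cast hK)]
  simpa using hKL.le_mul_norm (map_zero L) v

/-- Near `x` the derivatives of all nearby maps are within `c / 2` of one linear map that expands by
at least `c`, so the mean value inequality gives injectivity. The neighbourhood does not depend on
the parameter, which prevents distinct points of a multiple point from coalescing in the limit. -/
theorem ConvergesC1.eventually_injOn {T : Type*} {𝓕 : Filter T} {h : T → F → Space}
    {i : F → Space} (hi : IsSurfaceImmersion i) (hh : ConvergesC1 𝓕 h i) (x : F) :
    ∃ N ∈ 𝓝 x, ∀ᶠ t in 𝓕, InjOn (h t) N := by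
  set u₀ := extChartAt (𝓡 2) x x with hu₀
  set L := fderiv ℝ (chartRep i x) u₀ with hL
  obtain ⟨c, hc, hcL⟩ := exists_pos_mul_norm_le
    (injective_fderiv_chartRep hi (mem_extChartAt_source (I := 𝓡 2) x))
  have h1 : ∀ᶠ z in 𝓕 ×ˢ 𝓝 u₀, ‖fderiv ℝ (chartRep (h z.1) x) z.2 - L‖ < c / 2 := by
    have := Metric.tendsto_nhds.mp (hh.tendsto_fderiv_chartRep hi.1 x) (c / 2) (by positivity)
    simpa only [dist_eq_norm] using this
  obtain ⟨pa, hpa, pb, hpb, hab⟩ := eventually_prod_iff.mp h1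
  obtain ⟨r, hr, hball⟩ := Metric.mem_nhds_iff.mp
    (inter_mem hpb (extChartAt_target_mem_nhds (I := 𝓡 2) x))
  refine ⟨(extChartAt (𝓡 2) x).source ∩ extChartAt (𝓡 2) x ⁻¹' Metric.ball u₀ r,
    inter_mem (extChartAt_source_mem_nhds x)
      ((continuousAt_extChartAt x).preimage_mem_nhds (Metric.ball_mem_nhds _ hr)), ?_⟩
  filter_upwards [hpa, hh 1 one_pos] with t ht hclose y hy y' hy' heq
  have hmv := (convex_ball u₀ r).norm_image_sub_le_of_norm_fderiv_le' (f := chartRep (h t) x)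
    (φ := L) (C := c / 2)
    (fun u hu => ((contDiffOn_chartRep hclose.smooth x).differentiableOn (by simp)).differentiableAt
      ((isOpen_extChartAt_target x).mem_nhds (hball hu).2))
    (fun u hu => (hab ht (hball hu).1).le) hy.2 hy'.2
  rw [chartRep_extChartAt _ hy.1, chartRep_extChartAt _ hy'.1, heq, sub_self, zero_sub,
    norm_neg] at hmv
  have h2 := hcL (extChartAt (𝓡 2) x y' - extChartAt (𝓡 2) x y)
  have h3 : ‖extChartAt (𝓡 2) x y' - extChartAt (𝓡 2) x y‖ = 0 := by
    nlinarith [norm_nonneg (extChartAt (𝓡 2) x y' - extChartAt (𝓡 2) x y)]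
  exact ((extChartAt (𝓡 2) x).injOn hy'.1 hy.1 (sub_eq_zero.mp (norm_eq_zero.mp h3))).symm

/-- The tube lemma: compactness turns local estimates into a uniform one. -/
theorem eventually_forall_of_forall_eventually_prod {T X : Type*} [TopologicalSpace X]
    [CompactSpace X] {𝓕 : Filter T} {P : T → X → Prop}
    (hP : ∀ x, ∀ᶠ z in 𝓕 ×ˢ 𝓝 x, P z.1 z.2) : ∀ᶠ t in 𝓕, ∀ y, P t y := by
  have h1 : {z : T × X | P z.1 z.2} ∈ 𝓕 ×ˢ 𝓝ˢ (univ : Set X) :=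
    isCompact_univ.mem_prod_nhdsSet_of_forall fun x _ => hP x
  rw [nhdsSet_univ, mem_prod_top] at h1
  exact h1

/-- Multiple points of maps `C¹`-close to `i` come from multiple points of `i`: to establish a
property of all `m`-tuples of distinct points with the same image, it suffices to establish it
near the `m`-tuples of distinct points that have the same image under `i`. -/
theorem ConvergesC1.eventually_forall_tuple [CompactSpace F] {T : Type*} {𝓕 : Filter T}
    {h : T → F → Space} {i : F → Space} (hi : IsSurfaceImmersion i) (hh : ConvergesC1 𝓕 h i)
    {m : ℕ} {P : T → (Fin m → F) → Prop}
    (hP : ∀ x : Fin m → F, Function.Injective x → (∀ a b, i (x a) = i (x b)) →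
      ∀ᶠ z in 𝓕 ×ˢ 𝓝 x, Function.Injective z.2 →
        (∀ a b, h z.1 (z.2 a) = h z.1 (z.2 b)) → P z.1 z.2) :
    ∀ᶠ t in 𝓕, ∀ y : Fin m → F, Function.Injective y → (∀ a b, h t (y a) = h t (y b)) → P t y := by
  refine eventually_forall_of_forall_eventually_prod
    (P := fun t y => Function.Injective y → (∀ a b, h t (y a) = h t (y b)) → P t y) fun x => ?_
  have hproj : ∀ a, Tendsto (fun z : T × (Fin m → F) => (z.1, z.2 a)) (𝓕 ×ˢ 𝓝 x)
      (𝓕 ×ˢ 𝓝 (x a)) := fun a =>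
    tendsto_fst.prodMk (((continuous_apply a).tendsto x).comp tendsto_snd)
  -- Tuples near `x` are excluded if the limit images differ, by continuity, and if two entries of
  -- `x` coincide, by local injectivity. Only genuine multiple points of `i` remain for `hP`.
  by_cases hconst : ∀ a b, i (x a) = i (x b)
  · by_cases hinj : Function.Injective x
    · exact hP x hinj hconst
    · simp only [Function.Injective, not_forall] at hinj
      obtain ⟨a, b, hab, hne⟩ := hinj
      obtain ⟨N, hN, hinjN⟩ := hh.eventually_injOn hi (x a)
      filter_upwards [tendsto_fst.eventually hinjN,
        (hproj a).eventually (tendsto_snd.eventually hN),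
        (hproj b).eventually (tendsto_snd.eventually (hab ▸ hN))] with z h1 h2 h3 hz hc
      exact absurd (hz (h1 h2 h3 (hc a b))) hne
  · simp only [not_forall] at hconst
    obtain ⟨a, b, hab⟩ := hconst
    have h1 := (hh.tendsto_apply hi.1.continuous (x a)).comp (hproj a)
    have h2 := (hh.tendsto_apply hi.1.continuous (x b)).comp (hproj b)
    filter_upwards [(h1.sub h2).eventually_ne (sub_ne_zero.mpr hab)] with z hz _ hc
    exact absurd (sub_eq_zero.mpr (hc a b)) hz

/-- Linear independence of the normals is an open condition, and the normals converge jointly with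
the points. -/
theorem ConvergesC1.eventually_sheetsGeneric [CompactSpace F] {T : Type*} {𝓕 : Filter T}
    {h : T → F → Space} {i : F → Space} (hi : IsSurfaceImmersion i)
    (hgen : ∀ p, SheetsGeneric i p) (hh : ConvergesC1 𝓕 h i) :
    ∀ᶠ t in 𝓕, ∀ p, SheetsGeneric (h t) p := by
  classical
  have key : ∀ m : ℕ, m ≤ 3 → ∀ᶠ t in 𝓕, ∀ y : Fin m → F, Function.Injective y →
      (∀ a b, h t (y a) = h t (y b)) → InGeneralPosition (h t) (Finset.univ.image y) := by
    intro m hm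
    refine hh.eventually_forall_tuple hi fun x hx hc => ?_
    let N : (F → Space) → (Fin m → F) → Fin m → Space := fun g y a =>
      crossNormal (fderiv ℝ (chartRep g (x a)) (extChartAt (𝓡 2) (x a) (y a)))
    have hgp : ∀ (g : F → Space), IsSurfaceImmersion g → ∀ y : Fin m → F, Function.Injective y →
        (∀ a, y a ∈ (extChartAt (𝓡 2) (x a)).source) →
        (InGeneralPosition g (Finset.univ.image y) ↔ LinearIndependent ℝ (N g y)) := by
      intro g hg y hy hsrc
      have hn : ∀ w ∈ Finset.univ.image y, sheetPlane g w =
          (Submodule.span ℝ {Function.extend y (N g y) 0 w})ᗮ := by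
        intro w hw
        obtain ⟨a, -, rfl⟩ := Finset.mem_image.mp hw
        rw [hy.extend_apply, sheetPlane_eq_range_chartRep hg.1 (hsrc a)]
        exact range_eq_orthogonal_crossNormal (injective_fderiv_chartRep hg (hsrc a))
      rw [inGeneralPosition_iff _ hn]
      let e : Fin m ≃ (Finset.univ.image y : Finset F) := Equiv.ofBijective
        (fun a => ⟨y a, Finset.mem_image_of_mem y (Finset.mem_univ a)⟩)
        ⟨fun a b hab => hy (congrArg Subtype.val hab), fun ⟨w, hw⟩ => by
          obtain ⟨a, -, rfl⟩ := Finset.mem_image.mp hw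
          exact ⟨a, rfl⟩⟩
      rw [← linearIndependent_equiv e]
      have : (fun w : (Finset.univ.image y : Finset F) => Function.extend y (N g y) 0 w) ∘ e =
          N g y := funext fun a => hy.extend_apply (N g y) 0 a
      rw [this]
    have hx0 : LinearIndependent ℝ (N i x) := by
      refine (hgp i hi x hx fun a => mem_extChartAt_source _).mp ?_
      rcases isEmpty_or_nonempty (Fin m) with hm0 | ⟨⟨a⟩⟩
      · exact hgen 0 _ (by simp) (by simp)
      · refine hgen (i (x a)) _ (fun w hw => ?_) ?_
        · obtain ⟨b, -, rfl⟩ := Finset.mem_image.mp hw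
          exact hc b a
        · rw [Finset.card_image_of_injective _ hx]
          simpa using hm
    have hproj : ∀ a, Tendsto (fun z : T × (Fin m → F) => (z.1, z.2 a)) (𝓕 ×ˢ 𝓝 x)
        (𝓕 ×ˢ 𝓝 (x a)) := fun a =>
      tendsto_fst.prodMk (((continuous_apply a).tendsto x).comp tendsto_snd)
    have htend : Tendsto (fun z : T × (Fin m → F) => N (h z.1) z.2) (𝓕 ×ˢ 𝓝 x) (𝓝 (N i x)) := by
      refine tendsto_pi_nhds.mpr fun a => (continuous_crossNormal.tendsto _).comp ?_
      refine (hh.tendsto_fderiv_chartRep hi.1 (x a)).comp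
        (f := fun z : T × (Fin m → F) => (z.1, extChartAt (𝓡 2) (x a) (z.2 a))) ?_
      exact tendsto_fst.prodMk (((continuousAt_extChartAt (x a)).tendsto.comp
        (tendsto_snd (f := 𝓕))).comp (hproj a))
    have hsrc : ∀ᶠ z in 𝓕 ×ˢ 𝓝 x, ∀ a, z.2 a ∈ (extChartAt (𝓡 2) (x a)).source :=
      eventually_all.mpr fun a =>
        (hproj a).eventually (tendsto_snd.eventually (extChartAt_source_mem_nhds (x a)))
    have hinj : ∀ᶠ z in 𝓕 ×ˢ 𝓝 x, LinearIndependent ℝ (N (h z.1) z.2) :=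
      htend.eventually ((isOpen_setOfPred_linearIndependent (𝕜 := ℝ)).mem_nhds hx0)
    filter_upwards [hsrc, hinj, tendsto_fst.eventually (hh.eventually_isSurfaceImmersion hi)]
      with z h1 h2 h3 hz _
    exact (hgp _ h3 _ hz h1).mpr h2
  filter_upwards [key 0 (by norm_num), key 1 (by norm_num), key 2 (by norm_num),
    key 3 (by norm_num)] with t h0 h1 h2 h3 p A hAp hA
  have hk : ∀ y : Fin A.card → F, Function.Injective y →
      (∀ a b, h t (y a) = h t (y b)) → InGeneralPosition (h t) (Finset.univ.image y) := by
    interval_cases A.card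
    exacts [h0, h1, h2, h3]
  have := hk (fun a => A.equivFin.symm a)
    (Subtype.val_injective.comp A.equivFin.symm.injective)
    (fun a b => by rw [hAp _ (A.equivFin.symm a).2, hAp _ (A.equivFin.symm b).2])
  convert this
  ext w
  simp only [Finset.mem_image, Finset.mem_univ, true_and]
  constructor
  · exact fun hw => ⟨A.equivFin ⟨w, hw⟩, by simp⟩
  · rintro ⟨a, rfl⟩
    exact (A.equivFin.symm a).2

end C1Convergence

/-! ### Deformations to first order. -/

section Velocity

variable {F : Type*}

theorem velocity_eq_zero_of_forall_eq {i : F → Space} {G : ℝ → F → Space} {x : F}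
    (h : ∀ s ∈ Icc (0 : ℝ) 1, G s x = i x) : velocity G 0 x = 0 := by
  rw [velocity, derivWithin_congr (f := fun _ => i x) h (h 0 (by simp)), derivWithin_fun_const]
  rfl

/-- The deformation of `i` with constant velocity `V`. -/
def linearDeformation (i V : F → Space) (s : ℝ) (y : F) : Space := i y + s • V y

theorem velocity_linearDeformation (i V : F → Space) (x : F) :
    velocity (linearDeformation i V) 0 x = V x := by
  have h : HasDerivAt (fun s : ℝ => i x + s • V x) (V x) 0 := by
    simpa using ((hasDerivAt_id (0 : ℝ)).smul_const (V x)).const_add (i x)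
  exact h.hasDerivWithinAt.derivWithin (uniqueDiffOn_Icc zero_lt_one 0 (by simp))

end Velocity

section Deformations

variable {F : Type*} [TopologicalSpace F] [ChartedSpace Plane F]

theorem IsDeformation.contMDiff {i : F → Space} {G : ℝ → F → Space} (hG : IsDeformation i G)
    {s : ℝ} (hs : s ∈ Icc (0 : ℝ) 1) : ContMDiff (𝓡 2) 𝓘(ℝ, Space) ∞ (G s) := by
  rw [← contMDiffOn_univ]
  exact hG.1.comp (g := fun z : ℝ × F => G z.1 z.2)
    (contMDiffOn_const.prodMk contMDiffOn_id) (fun y _ => ⟨hs, mem_univ y⟩)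

theorem isDeformation_linearDeformation {i V : F → Space}
    (hi : ContMDiff (𝓡 2) 𝓘(ℝ, Space) ∞ i) (hV : ContMDiff (𝓡 2) 𝓘(ℝ, Space) ∞ V) :
    IsDeformation i (linearDeformation i V) := by
  refine ⟨ContMDiff.contMDiffOn ?_, funext fun y => by simp [linearDeformation]⟩
  exact (hi.comp contMDiff_snd).add (contMDiff_fst.smul (hV.comp contMDiff_snd))

variable [IsManifold (𝓡 2) ∞ F]

/-- Smoothness is only given on `[0,1] × F`, so derivatives are taken within this set; they are
continuous up to the boundary time `0`. -/
theorem IsSmoothHomotopy.exists_hasFDerivWithinAt {G : ℝ → F → Space} (hG : IsSmoothHomotopy G)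
    (x : F) : ∃ g' : ℝ × Plane → (ℝ × Plane →L[ℝ] Space),
      ContinuousOn g' (Icc 0 1 ×ˢ (extChartAt (𝓡 2) x).target) ∧
      ∀ z ∈ Icc (0 : ℝ) 1 ×ˢ (extChartAt (𝓡 2) x).target,
        HasFDerivWithinAt (fun z : ℝ × Plane => chartRep (G z.1) x z.2) (g' z)
          (Icc 0 1 ×ˢ (extChartAt (𝓡 2) x).target) z := by
  have hS : UniqueDiffOn ℝ (Icc (0 : ℝ) 1 ×ˢ (extChartAt (𝓡 2) x).target) :=
    (uniqueDiffOn_Icc zero_lt_one).prod (isOpen_extChartAt_target x).uniqueDiffOn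
  have hg : ContDiffOn ℝ ∞ (fun z : ℝ × Plane => chartRep (G z.1) x z.2)
      (Icc 0 1 ×ˢ (extChartAt (𝓡 2) x).target) := by
    rw [← contMDiffOn_iff_contDiffOn]
    refine ContMDiffOn.comp (g := fun z : ℝ × F => G z.1 z.2)
      (f := fun z : ℝ × Plane => (z.1, (extChartAt (𝓡 2) x).symm z.2)) hG ?_
      (fun z hz => ⟨hz.1, mem_univ _⟩)
    exact contDiff_fst.contMDiff.contMDiffOn.prodMk
      ((contMDiffOn_extChartAt_symm x).comp contDiff_snd.contMDiff.contMDiffOn fun z hz => hz.2)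
  exact ⟨_, hg.continuousOn_fderivWithin hS (by simp),
    fun z hz => (hg.differentiableOn (by simp) z hz).hasFDerivWithinAt⟩

theorem IsDeformation.convergesC1 [CompactSpace F] {i : F → Space} {G : ℝ → F → Space}
    (hi : IsSurfaceImmersion i) (hG : IsDeformation i G) :
    ConvergesC1 (𝓝[>] 0) G i := by
  intro ε hε
  have hsub : 𝓝[>] (0 : ℝ) ≤ 𝓝[Icc 0 1] 0 := by
    rw [← nhdsWithin_Ioo_eq_nhdsGT (zero_lt_one (α := ℝ))]
    exact nhdsWithin_mono _ Ioo_subset_Icc_self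
  refine hsub ?_
  have hmain : ∀ᶠ s in 𝓝[Icc 0 1] (0 : ℝ), ∀ y, s ∈ Icc (0 : ℝ) 1 → ‖G s y - i y‖ ≤ ε ∧
      ∀ v, ‖differential (G s) y v - differential i y v‖ ≤ ε * ‖differential i y v‖ := by
    refine eventually_forall_of_forall_eventually_prod (P := fun s y => s ∈ Icc (0 : ℝ) 1 →
      ‖G s y - i y‖ ≤ ε ∧
      ∀ v, ‖differential (G s) y v - differential i y v‖ ≤ ε * ‖differential i y v‖) fun x => ?_
    obtain ⟨g', hg', hgd⟩ := hG.1.exists_hasFDerivWithinAt x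
    set u₀ := extChartAt (𝓡 2) x x with hu₀
    set S := Icc (0 : ℝ) 1 ×ˢ (extChartAt (𝓡 2) x).target with hS
    have hu₀t : u₀ ∈ (extChartAt (𝓡 2) x).target := mem_extChartAt_target x
    have h0 : (0, u₀) ∈ S := ⟨by simp, hu₀t⟩
    have hslice : ∀ s ∈ Icc (0 : ℝ) 1, ∀ u ∈ (extChartAt (𝓡 2) x).target,
        fderiv ℝ (chartRep (G s) x) u = (g' (s, u)).comp (ContinuousLinearMap.inr ℝ ℝ Plane) := by
      intro s hs u hu
      have h1 := (hgd (s, u) ⟨hs, hu⟩).comp u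
        (f := fun u => (s, u)) (t := Icc (0 : ℝ) 1 ×ˢ (extChartAt (𝓡 2) x).target)
        (s := (extChartAt (𝓡 2) x).target)
        (hasFDerivAt_prodMk_right (𝕜 := ℝ) s u).hasFDerivWithinAt (fun u hu => ⟨hs, hu⟩)
      exact (h1.hasFDerivAt ((isOpen_extChartAt_target x).mem_nhds hu)).fderiv
    have hL := injective_fderiv_chartRep hi (mem_extChartAt_source (I := 𝓡 2) x)
    obtain ⟨c, hc, hcL⟩ := exists_pos_mul_norm_le hL
    have hz : Tendsto (fun z : ℝ × F => (z.1, extChartAt (𝓡 2) x z.2))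
        (𝓝[Icc 0 1] 0 ×ˢ 𝓝 x) (𝓝[S] (0, u₀)) := by
      rw [nhdsWithin_prod_eq, (isOpen_extChartAt_target x).nhdsWithin_eq hu₀t]
      exact tendsto_fst.prodMk ((continuousAt_extChartAt x).tendsto.comp tendsto_snd)
    have hz0 : Tendsto (fun z : ℝ × F => ((0 : ℝ), extChartAt (𝓡 2) x z.2))
        (𝓝[Icc 0 1] 0 ×ˢ 𝓝 x) (𝓝[S] (0, u₀)) := by
      rw [nhdsWithin_prod_eq, (isOpen_extChartAt_target x).nhdsWithin_eq hu₀t]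
      refine Tendsto.prodMk ?_ ((continuousAt_extChartAt x).tendsto.comp tendsto_snd)
      exact tendsto_const_pure.mono_right (pure_le_nhdsWithin (by simp))
    have hA : Tendsto (fun z => (g' z).comp (ContinuousLinearMap.inr ℝ ℝ Plane))
        (𝓝[S] (0, u₀)) (𝓝 ((g' (0, u₀)).comp (ContinuousLinearMap.inr ℝ ℝ Plane))) :=
      ((ContinuousLinearMap.compL ℝ Plane (ℝ × Plane) Space).flip
        (ContinuousLinearMap.inr ℝ ℝ Plane)).continuous.continuousAt.tendsto.comp (hg' _ h0)
    have hg : Tendsto (fun z : ℝ × Plane => chartRep (G z.1) x z.2)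
        (𝓝[S] (0, u₀)) (𝓝 (chartRep (G 0) x u₀)) := (hgd _ h0).continuousWithinAt
    -- Near `x` the differential of `i` expands by at least `c / 2`, so the bound `ε * (c / 2)` on
    -- the operator norm yields the relative bound `ε` required by `C1Close`.
    have e1 := Metric.tendsto_nhds.mp ((hA.comp hz).sub (hA.comp hz0)) (ε * (c / 2))
      (by positivity)
    have e2 := Metric.tendsto_nhds.mp (hA.comp hz0) (c / 2) (by positivity)
    have e3 := Metric.tendsto_nhds.mp ((hg.comp hz).sub (hg.comp hz0)) ε hε
    rw [← hslice 0 (by simp) u₀ hu₀t, hG.2] at e2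
    filter_upwards [e1, e2, e3, tendsto_snd.eventually (extChartAt_source_mem_nhds (I := 𝓡 2) x)]
      with ⟨s, y⟩ e1 e2 e3 hy hs
    have hyt := (extChartAt (𝓡 2) x).map_source hy
    simp only [Function.comp_apply, sub_self, dist_zero_right] at e1 e2 e3
    rw [← hslice s hs _ hyt, ← hslice 0 (by simp) _ hyt, hG.2] at e1
    rw [← hslice 0 (by simp) _ hyt, hG.2, dist_eq_norm] at e2
    rw [chartRep_extChartAt _ hy, chartRep_extChartAt _ hy, hG.2] at e3
    refine ⟨e3.le, fun v => ?_⟩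
    rw [differential_eq_comp (hG.contMDiff hs) hy, differential_eq_comp hi.1 hy]
    set w : Plane := mfderiv (𝓡 2) 𝓘(ℝ, Plane) (extChartAt (𝓡 2) x) y v
    set A := fderiv ℝ (chartRep (G s) x) (extChartAt (𝓡 2) x y)
    set B := fderiv ℝ (chartRep i x) (extChartAt (𝓡 2) x y)
    set L := fderiv ℝ (chartRep i x) u₀
    change ‖A w - B w‖ ≤ ε * ‖B w‖
    have f1 : ‖A w - B w‖ ≤ ε * (c / 2) * ‖w‖ := (A - B).le_of_opNorm_le e1.le w
    have f2 : ‖B w - L w‖ ≤ c / 2 * ‖w‖ := (B - L).le_of_opNorm_le e2.le w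
    have f3 := hcL w
    have f4 : ‖L w‖ ≤ ‖B w‖ + ‖B w - L w‖ := by
      rw [norm_sub_rev]
      calc ‖L w‖ = ‖B w + (L w - B w)‖ := by rw [add_sub_cancel]
        _ ≤ _ := norm_add_le _ _
    have f5 : c / 2 * ‖w‖ ≤ ‖B w‖ := by linarith
    calc _ ≤ ε * (c / 2 * ‖w‖) := by linarith
      _ ≤ ε * ‖B w‖ := by gcongr
  filter_upwards [hmain, self_mem_nhdsWithin] with s hs hs1
  exact ⟨hG.contMDiff hs1, fun y => (hs y hs1).1, fun y => (hs y hs1).2⟩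

/-- The displacement of all points near `x` is approximated by the velocity at `x` itself, with an
error linear in time. This is the mean value inequality in the time direction, with the derivative
compared to its value at time `0` and the point `x`. -/
theorem IsDeformation.eventually_norm_sub_le {i : F → Space} {G : ℝ → F → Space}
    (hG : IsDeformation i G) (x : F) {η : ℝ} (hη : 0 < η) :
    ∀ᶠ z : ℝ × F in 𝓝[>] 0 ×ˢ 𝓝 x,
      ‖G z.1 z.2 - i z.2 - z.1 • velocity G 0 x‖ ≤ η * z.1 := by
  obtain ⟨g', hg', hgd⟩ := hG.1.exists_hasFDerivWithinAt x
  set u₀ := extChartAt (𝓡 2) x x with hu₀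
  set S := Icc (0 : ℝ) 1 ×ˢ (extChartAt (𝓡 2) x).target with hS
  have hu₀t : u₀ ∈ (extChartAt (𝓡 2) x).target := mem_extChartAt_target x
  have h0 : (0, u₀) ∈ S := ⟨by simp, hu₀t⟩
  have hvel : velocity G 0 x = g' (0, u₀) (1, 0) := by
    have h1 := (hgd (0, u₀) h0).comp_hasDerivWithinAt (f := fun s : ℝ => (s, u₀))
      (f' := ((1 : ℝ), (0 : Plane))) (s := Icc (0 : ℝ) 1) 0
      ((hasDerivAt_id (0 : ℝ)).prodMk (hasDerivAt_const _ _)).hasDerivWithinAt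
      (fun s hs => ⟨hs, hu₀t⟩)
    have h2 := h1.derivWithin (uniqueDiffOn_Icc zero_lt_one 0 (by simp))
    rw [← h2, velocity]
    congr 1
    funext s
    exact (chartRep_extChartAt (G s) (mem_extChartAt_source x)).symm
  have hclose : ∀ᶠ z in 𝓝[S] (0, u₀), ‖g' z - g' (0, u₀)‖ < η := by
    simpa only [dist_eq_norm] using Metric.tendsto_nhds.mp (hg' _ h0) η hη
  rw [eventually_nhdsWithin_iff, Metric.eventually_nhds_iff_ball] at hclose
  obtain ⟨r, hr, hball⟩ := hclose
  obtain ⟨r', hr', hball'⟩ := Metric.mem_nhds_iff.mp (extChartAt_target_mem_nhds (I := 𝓡 2) x)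
  set ρ := min r r' with hρ
  have hρ0 : 0 < ρ := lt_min hr hr'
  set C := (Icc (0 : ℝ) 1 ×ˢ (univ : Set Plane)) ∩ Metric.ball ((0 : ℝ), u₀) ρ with hC
  have hCS : C ⊆ S := by
    rintro ⟨s, u⟩ ⟨hs, hu⟩
    rw [← ball_prod_same] at hu
    exact ⟨hs.1, hball' (Metric.ball_subset_ball (min_le_right _ _) hu.2)⟩
  have hCconv : Convex ℝ C := ((convex_Icc 0 1).prod convex_univ).inter (convex_ball _ _)
  have hmem : ∀ᶠ z : ℝ × F in 𝓝[>] 0 ×ˢ 𝓝 x,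
      z.1 ∈ Ioo (0 : ℝ) (min 1 ρ) ∧ extChartAt (𝓡 2) x z.2 ∈ Metric.ball u₀ ρ ∧
        z.2 ∈ (extChartAt (𝓡 2) x).source :=
    (tendsto_fst.eventually (Ioo_mem_nhdsGT (by positivity))).and
      ((tendsto_snd.eventually ((continuousAt_extChartAt x).preimage_mem_nhds
        (Metric.ball_mem_nhds _ hρ0))).and
        (tendsto_snd.eventually (extChartAt_source_mem_nhds (I := 𝓡 2) x)))
  filter_upwards [hmem] with ⟨s, y⟩ ⟨hs, hu, hy⟩
  have hs1 : s < 1 := lt_of_lt_of_le hs.2 (min_le_left _ _)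
  have hsρ : s < ρ := lt_of_lt_of_le hs.2 (min_le_right _ _)
  have hs0 : 0 < s := hs.1
  have m0 : ((0 : ℝ), extChartAt (𝓡 2) x y) ∈ C := by
    refine ⟨⟨by simp, mem_univ _⟩, ?_⟩
    rw [← ball_prod_same]
    exact ⟨by simpa using hρ0, hu⟩
  have m1 : (s, extChartAt (𝓡 2) x y) ∈ C := by
    refine ⟨⟨⟨hs0.le, hs1.le⟩, mem_univ _⟩, ?_⟩
    rw [← ball_prod_same]
    exact ⟨by simpa [abs_of_pos hs0] using hsρ, hu⟩
  have hmv := hCconv.norm_image_sub_le_of_norm_hasFDerivWithin_le' (C := η) (φ := g' (0, u₀))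
    (fun z hz => (hgd z (hCS hz)).mono hCS)
    (fun z hz => (hball z (Metric.ball_subset_ball (min_le_left _ _) hz.2) (hCS hz)).le) m0 m1
  have hdiff : (s, extChartAt (𝓡 2) x y) - ((0 : ℝ), extChartAt (𝓡 2) x y) =
      s • ((1 : ℝ), (0 : Plane)) := by
    ext <;> simp
  rw [hdiff, map_smul, ← hvel, norm_smul] at hmv
  simp only [chartRep_extChartAt _ hy, hG.2] at hmv
  simpa [abs_of_pos hs0, Prod.norm_def] using hmv

/-- The values are interpolated by bump functions, each vanishing at the other points of `A`. -/
theorem exists_contMDiff_eq_on_finset [T2Space F] (A : Finset F) (w : F → Space) :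
    ∃ V : F → Space, ContMDiff (𝓡 2) 𝓘(ℝ, Space) ∞ V ∧ ∀ x ∈ A, V x = w x := by
  classical
  have hb : ∀ x : F, ∃ f : SmoothBumpFunction (𝓡 2) x, ∀ y ∈ A, y ≠ x → f y = 0 := by
    intro x
    have hnhds : ((A.erase x : Finset F) : Set F)ᶜ ∈ 𝓝 x :=
      (A.erase x).finite_toSet.isClosed.isOpen_compl.mem_nhds (by simp)
    obtain ⟨f, -, hf⟩ := (SmoothBumpFunction.nhds_basis_support (I := 𝓡 2) hnhds).mem_iff.mp hnhds
    refine ⟨f, fun y hy hyx => ?_⟩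
    by_contra h0
    exact hf (Function.mem_support.mpr h0) (by simp [hy, hyx])
  choose f hf using hb
  refine ⟨fun y => ∑ x ∈ A, f x y • w x, ?_, fun x hx => ?_⟩
  · exact ContMDiff.sum fun x _ => (f x).contMDiff.smul contMDiff_const
  · change ∑ y ∈ A, f y x • w y = w x
    rw [Finset.sum_eq_single_of_mem x hx (fun y _ hyx => by rw [hf y x hx hyx.symm, zero_smul]),
      (f x).eq_one, one_smul]

end Deformations

/-! ### First order estimates near multiple points. -/

section LocalAnalysis

variable {F : Type*} [TopologicalSpace F] [ChartedSpace Plane F]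

theorem exists_pos_forall_norm_le {ι : Type*} [Fintype ι] {ν : ι → Covector}
    (hspan : ∀ w, (∀ a, ν a w = 0) → w = 0) :
    ∃ c : ℝ, 0 < c ∧ ∀ (w : Space) (b : ℝ), 0 ≤ b → (∀ a, |ν a w| ≤ b) → c * ‖w‖ ≤ b := by
  have hker : LinearMap.ker (ContinuousLinearMap.pi ν).toLinearMap = ⊥ := by
    rw [LinearMap.ker_eq_bot']
    exact fun w hw => hspan w fun a => congrFun hw a
  obtain ⟨K, hK, hKL⟩ := (ContinuousLinearMap.pi ν).toLinearMap.exists_antilipschitzWith hker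
  refine ⟨(K : ℝ)⁻¹, by positivity, fun w b hb hw => ?_⟩
  rw [inv_mul_le_iff₀ (by exact_mod_cast hK)]
  refine (hKL.le_mul_norm (map_zero _) w).trans ?_
  gcongr
  exact (pi_norm_le_iff_of_nonneg hb).mpr hw

variable [IsManifold (𝓡 2) ∞ F]

/-- To first order a sheet stays in its tangent plane. -/
theorem IsConormal.eventually_abs_le {i : F → Space} (hi : IsSurfaceImmersion i) {x : F}
    {ν : Covector} (hν : IsConormal i x ν) {η : ℝ} (hη : 0 < η) :
    ∀ᶠ y in 𝓝 x, |ν (i y - i x)| ≤ η * ‖i y - i x‖ := by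
  set u₀ := extChartAt (𝓡 2) x x with hu₀
  set L := fderiv ℝ (chartRep i x) u₀ with hL
  obtain ⟨c, hc, hcL⟩ := exists_pos_mul_norm_le
    (injective_fderiv_chartRep hi (mem_extChartAt_source (I := 𝓡 2) x))
  have hd : HasFDerivAt (chartRep i x) L u₀ :=
    (((contDiffOn_chartRep hi.1 x).differentiableOn (by simp)).differentiableAt
      (extChartAt_target_mem_nhds x)).hasFDerivAt
  -- The first bound makes distances in the chart comparable to distances in space; the second
  -- bounds the conormal component of the remainder.
  set κ := min (c / 2) (η * c / (2 * (‖ν‖ + 1))) with hκ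
  have hκ0 : 0 < κ := lt_min (by positivity) (by positivity)
  have h1 := (hasFDerivAt_iff_isLittleO.mp hd).def hκ0
  filter_upwards [(continuousAt_extChartAt (I := 𝓡 2) x).eventually h1,
    extChartAt_source_mem_nhds (I := 𝓡 2) x] with y hy hsrc
  rw [chartRep_extChartAt _ hsrc, chartRep_extChartAt _ (mem_extChartAt_source x)] at hy
  set v := extChartAt (𝓡 2) x y - u₀
  set w := i y - i x
  have h2 := hcL v
  have h3 : ‖L v‖ ≤ ‖w‖ + ‖w - L v‖ := by
    calc ‖L v‖ = ‖w - (w - L v)‖ := by rw [sub_sub_cancel]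
      _ ≤ _ := norm_sub_le _ _
  have hκ1 : κ ≤ c / 2 := min_le_left _ _
  have hκ2 : κ ≤ η * c / (2 * (‖ν‖ + 1)) := min_le_right _ _
  have h4 : c / 2 * ‖v‖ ≤ ‖w‖ := by
    have : κ * ‖v‖ ≤ c / 2 * ‖v‖ := by gcongr
    linarith
  have h5 : ν w = ν (w - L v) := by
    have h6 : ν (L v) = 0 := hν.apply_fderiv_chartRep hi.1 v
    rw [map_sub ν w (L v), h6, sub_zero]
  rw [h5]
  calc |ν (w - L v)| ≤ ‖ν‖ * ‖w - L v‖ := ν.le_opNorm _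
    _ ≤ (‖ν‖ + 1) * (η * c / (2 * (‖ν‖ + 1)) * ‖v‖) := by
      gcongr
      · linarith
      · exact hy.trans (by gcongr)
    _ = η * (c / 2 * ‖v‖) := by field_simp
    _ ≤ η * ‖w‖ := by gcongr

/-- If sheets whose tangent planes have no common direction pass within `r` of a point near their
common point `q`, then this point is within a fixed multiple of `r` of `q`. -/
theorem exists_norm_sub_le_of_transverse {ι : Type*} [Fintype ι] {i : F → Space}
    (hi : IsSurfaceImmersion i) {x : ι → F} {q : Space} (hxq : ∀ a, i (x a) = q)
    {ν : ι → Covector} (hν : ∀ a, IsConormal i (x a) (ν a))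
    (hspan : ∀ w, (∀ a, ν a w = 0) → w = 0) :
    ∃ C : ℝ, 0 ≤ C ∧ ∀ᶠ y in 𝓝 x, ∀ (P : Space) (r : ℝ), 0 ≤ r → (∀ a, ‖i (y a) - P‖ ≤ r) →
      ‖P - q‖ ≤ C * r := by
  obtain ⟨c, hc, hcw⟩ := exists_pos_forall_norm_le hspan
  set M := ∑ a, ‖ν a‖ with hM
  have hMa : ∀ a, ‖ν a‖ ≤ M := fun a =>
    Finset.single_le_sum (f := fun a => ‖ν a‖) (fun _ _ => norm_nonneg _) (Finset.mem_univ a)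
  have hM0 : 0 ≤ M := Finset.sum_nonneg fun _ _ => norm_nonneg _
  refine ⟨2 / c * (c / 2 + M), by positivity, ?_⟩
  have h1 : ∀ᶠ y in 𝓝 x, ∀ a, |ν a (i (y a) - i (x a))| ≤ c / 2 * ‖i (y a) - i (x a)‖ :=
    eventually_all.mpr fun a => (continuous_apply a).continuousAt.eventually
      ((hν a).eventually_abs_le hi (η := c / 2) (by positivity))
  filter_upwards [h1] with y hy P r hr hP
  have h2 : ∀ a, |ν a (P - q)| ≤ c / 2 * (‖P - q‖ + r) + M * r := by
    intro a
    have e1 : P - q = (i (y a) - q) - (i (y a) - P) := by abel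
    have e2 : ‖i (y a) - q‖ ≤ ‖P - q‖ + r := by
      calc ‖i (y a) - q‖ = ‖(P - q) + (i (y a) - P)‖ := by congr 1; abel
        _ ≤ _ := norm_add_le _ _
        _ ≤ _ := by gcongr; exact hP a
    have e3 := hy a
    rw [hxq a] at e3
    have e4 : |ν a (i (y a) - P)| ≤ M * r :=
      ((ν a).le_opNorm _).trans (by gcongr; exacts [hMa a, hP a])
    calc |ν a (P - q)| = |ν a (i (y a) - q) - ν a (i (y a) - P)| := by rw [← map_sub, ← e1]
      _ ≤ |ν a (i (y a) - q)| + |ν a (i (y a) - P)| := abs_sub _ _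
      _ ≤ c / 2 * (‖P - q‖ + r) + M * r := by
        gcongr
        exact e3.trans (by gcongr)
  have h3 := hcw (P - q) _ (by positivity) h2
  have h4 : c / 2 * ‖P - q‖ ≤ (c / 2 + M) * r := by nlinarith
  calc ‖P - q‖ = 2 / c * (c / 2 * ‖P - q‖) := by field_simp
    _ ≤ 2 / c * ((c / 2 + M) * r) := by gcongr
    _ = _ := by ring

/-- If sheets through a common point still meet after displacements `D a`, then the conormal
relation among them nearly vanishes on the displacements. -/
theorem exists_abs_sum_le_of_displaced {ι : Type*} [Fintype ι] [Nonempty ι] {i : F → Space}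
    (hi : IsSurfaceImmersion i) {x : ι → F} {q : Space} (hxq : ∀ a, i (x a) = q)
    {ν : ι → Covector} (hν : ∀ a, IsConormal i (x a) (ν a)) (hsum : ∑ a, ν a = 0)
    (hspan : ∀ w, (∀ a, ν a w = 0) → w = 0) {κ : ℝ} (hκ : 0 < κ) :
    ∃ κ' : ℝ, 0 < κ' ∧ ∀ᶠ y in 𝓝 x, ∀ (D d : ι → Space) (r : ℝ), 0 ≤ r →
      (∀ a b, i (y a) + D a = i (y b) + D b) → (∀ a, ‖D a - d a‖ ≤ κ' * r) →
      (∀ a, ‖d a‖ ≤ r) → |∑ a, ν a (d a)| ≤ κ * r := by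
  obtain ⟨C, hC, hloc⟩ := exists_norm_sub_le_of_transverse hi hxq hν hspan
  set M := ∑ a, ‖ν a‖ with hM
  have hM0 : 0 ≤ M := Finset.sum_nonneg fun _ _ => norm_nonneg _
  obtain ⟨N, hN⟩ : ∃ N : ℝ, N = (Fintype.card ι : ℝ) := ⟨_, rfl⟩
  have hN0 : 0 ≤ N := hN ▸ Nat.cast_nonneg _
  set η := κ / (2 * (N + 1) * (2 * C + 2)) with hη
  -- The curvature of the sheets, controlled by `η`, and the error `D - d` are each allowed half of
  -- `κ * r`.
  set κ' := min 1 (κ / (2 * (M + 1))) with hκ'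
  have hκ'0 : 0 < κ' := lt_min one_pos (by positivity)
  refine ⟨κ', hκ'0, ?_⟩
  have h1 : ∀ᶠ y in 𝓝 x, ∀ a, |ν a (i (y a) - i (x a))| ≤ η * ‖i (y a) - i (x a)‖ :=
    eventually_all.mpr fun a => (continuous_apply a).continuousAt.eventually
      ((hν a).eventually_abs_le hi (η := η) (by positivity))
  filter_upwards [hloc, h1] with y hy hη' D d r hr hD hDd hd
  obtain ⟨a₀⟩ := ‹Nonempty ι›
  set P := i (y a₀) + D a₀ with hP
  have hPa : ∀ a, P = i (y a) + D a := fun a => hD a₀ a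
  have hκ'1 : κ' ≤ 1 := min_le_left _ _
  have hκ'2 : κ' ≤ κ / (2 * (M + 1)) := min_le_right _ _
  have hDr : ∀ a, ‖D a‖ ≤ 2 * r := by
    intro a
    calc ‖D a‖ = ‖(D a - d a) + d a‖ := by rw [sub_add_cancel]
      _ ≤ ‖D a - d a‖ + ‖d a‖ := norm_add_le _ _
      _ ≤ κ' * r + r := add_le_add (hDd a) (hd a)
      _ ≤ 1 * r + r := by gcongr
      _ = 2 * r := by ring
  have hPq := hy P (2 * r) (by positivity) fun a => by
    rw [hPa a, sub_add_cancel_left, norm_neg]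
    exact hDr a
  have hiq : ∀ a, |ν a (i (y a) - q)| ≤ η * ((2 * C + 2) * r) := by
    intro a
    have e1 : ‖i (y a) - q‖ ≤ (2 * C + 2) * r := by
      calc ‖i (y a) - q‖ = ‖(P - q) - D a‖ := by rw [hPa a]; congr 1; abel
        _ ≤ ‖P - q‖ + ‖D a‖ := norm_sub_le _ _
        _ ≤ C * (2 * r) + 2 * r := add_le_add hPq (hDr a)
        _ = _ := by ring
    have e2 := hη' a
    rw [hxq a] at e2
    exact e2.trans (by gcongr)
  -- The position of the common point drops out because the conormals sum to zero; only the
  -- displacements remain.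
  have hzero : ∑ a, ν a (P - q) = 0 := by
    rw [← sum_apply, hsum, zero_apply]
  have hsplit : ∑ a, ν a (d a) = -(∑ a, ν a (i (y a) - q)) - ∑ a, ν a (D a - d a) := by
    have : ∑ a, ν a (P - q) =
        ∑ a, ν a (i (y a) - q) + ∑ a, ν a (D a - d a) + ∑ a, ν a (d a) := by
      rw [← Finset.sum_add_distrib, ← Finset.sum_add_distrib]
      refine Finset.sum_congr rfl fun a _ => ?_
      rw [← map_add, ← map_add, hPa a]
      congr 1
      abel
    linarith
  have hb1 : |∑ a, ν a (i (y a) - q)| ≤ N * (η * ((2 * C + 2) * r)) := by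
    refine (Finset.abs_sum_le_sum_abs _ _).trans ?_
    refine (Finset.sum_le_sum fun a _ => hiq a).trans ?_
    rw [Finset.sum_const, Finset.card_univ, nsmul_eq_mul, hN]
  have hb2 : |∑ a, ν a (D a - d a)| ≤ M * (κ' * r) := by
    refine (Finset.abs_sum_le_sum_abs _ _).trans ?_
    rw [hM, Finset.sum_mul]
    exact Finset.sum_le_sum fun a _ => ((ν a).le_opNorm _).trans (by gcongr; exact hDd a)
  have hb3 : N * (η * ((2 * C + 2) * r)) ≤ κ / 2 * r := by
    have : N * (η * ((2 * C + 2) * r)) = N / (N + 1) * (κ / 2 * r) := by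
      rw [hη]; field_simp
    rw [this]
    have h2 : N / (N + 1) ≤ 1 := by rw [div_le_one (by positivity)]; linarith
    calc _ ≤ 1 * (κ / 2 * r) := by gcongr
      _ = _ := one_mul _
  have hb4 : M * (κ' * r) ≤ κ / 2 * r := by
    calc M * (κ' * r) ≤ (M + 1) * (κ / (2 * (M + 1)) * r) := by gcongr; linarith
      _ = κ / 2 * r := by field_simp
  rw [hsplit]
  calc _ ≤ |-(∑ a, ν a (i (y a) - q))| + |∑ a, ν a (D a - d a)| := abs_sub _ _
    _ ≤ κ * r := by rw [abs_neg]; linarith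

/-- A sheet that is pushed off its tangent plane at `x` leaves the point `i x`. -/
theorem IsDeformation.eventually_apply_ne {i : F → Space} (hi : IsSurfaceImmersion i)
    {G : ℝ → F → Space} (hG : IsDeformation i G) {x : F} (hv : velocity G 0 x ∉ sheetPlane i x) :
    ∀ᶠ z : ℝ × F in 𝓝[>] 0 ×ˢ 𝓝 x, G z.1 z.2 ≠ i x := by
  set ν : Covector := innerSL ℝ (sheetNormal i x) with hνdef
  have hν : IsConormal i x ν := isConormal_sheetNormal i x
  have hν0 : ν ≠ 0 := by
    intro h
    have h2 := congrArg (fun φ : Covector => φ (sheetNormal i x)) h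
    simp only [hνdef, innerSL_apply_apply, zero_apply, inner_self_eq_zero] at h2
    exact crossNormal_ne_zero (hi.2 x) h2
  set V := velocity G 0 x with hV
  have hc : ν V ≠ 0 := fun h => hv (hν.mem_sheetPlane (hi.2 x) hν0 h)
  set c := |ν V| with hcdef
  have hc0 : 0 < c := abs_pos.mpr hc
  set κ := min 1 (c / (4 * (‖ν‖ + 1))) with hκ
  have hκ0 : 0 < κ := lt_min one_pos (by positivity)
  have h2 : ∀ᶠ y in 𝓝 x, |ν (i y - i x)| ≤ c / (4 * (‖V‖ + 1)) * ‖i y - i x‖ :=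
    hν.eventually_abs_le hi (by positivity)
  have hs : ∀ᶠ z : ℝ × F in 𝓝[>] 0 ×ˢ 𝓝 x, 0 < z.1 :=
    tendsto_fst.eventually self_mem_nhdsWithin
  filter_upwards [hG.eventually_norm_sub_le x hκ0, tendsto_snd.eventually h2, hs]
    with ⟨s, y⟩ h1 h2 hs heq
  simp only at h1 h2 hs heq
  rw [heq] at h1
  have hκ1 : κ ≤ 1 := min_le_left _ _
  have hκ2 : κ ≤ c / (4 * (‖ν‖ + 1)) := min_le_right _ _
  have e1 : ‖i y - i x‖ ≤ (‖V‖ + 1) * s := by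
    calc ‖i y - i x‖ = ‖(i x - i y - s • V) + s • V‖ := by rw [norm_sub_rev, sub_add_cancel]
      _ ≤ ‖i x - i y - s • V‖ + ‖s • V‖ := norm_add_le _ _
      _ ≤ κ * s + s * ‖V‖ := by
        rw [norm_smul, Real.norm_of_nonneg hs.le]
        gcongr
      _ ≤ 1 * s + s * ‖V‖ := by gcongr
      _ = _ := by ring
  have e2 : s * ν V = -ν (i y - i x) - ν (i x - i y - s • V) := by
    simp only [map_sub, map_smul, smul_eq_mul]
    ring
  have e3 : |ν (i x - i y - s • V)| ≤ c / 4 * s := by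
    calc _ ≤ ‖ν‖ * ‖i x - i y - s • V‖ := ν.le_opNorm _
      _ ≤ (‖ν‖ + 1) * (c / (4 * (‖ν‖ + 1)) * s) := by
        gcongr
        · linarith
        · exact h1.trans (by gcongr)
      _ = c / 4 * s := by field_simp
  have e4 : |ν (i y - i x)| ≤ c / 4 * s := by
    calc _ ≤ c / (4 * (‖V‖ + 1)) * ((‖V‖ + 1) * s) := h2.trans (by gcongr)
      _ = c / 4 * s := by field_simp
  have e5 : s * c ≤ c / 4 * s + c / 4 * s := by
    calc s * c = |s * ν V| := by rw [abs_mul, abs_of_pos hs]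
      _ ≤ |-ν (i y - i x)| + |ν (i x - i y - s • V)| := by rw [e2]; exact abs_sub _ _
      _ ≤ _ := by rw [abs_neg]; exact add_le_add e4 e3
  nlinarith [mul_pos hs hc0]

end LocalAnalysis

/-! ### Multiplicities and the effect of pushing a sheet. -/

section Tuples

theorem exists_injective_fin_of_le_encard {α : Type*} {S : Set α} {m : ℕ} (hm : 1 ≤ m)
    (h : (m : ℕ∞) ≤ S.encard) {z : α} (hz : z ∈ S) :
    ∃ y : Fin m → α, Function.Injective y ∧ (∀ a, y a ∈ S) ∧ ∃ a, y a = z := by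
  obtain ⟨t, hzt, htS, ht⟩ := Set.exists_superset_subset_encard_eq (singleton_subset_iff.mpr hz)
    (by rw [encard_singleton]; exact_mod_cast hm) h
  have hfin : t.Finite := finite_of_encard_eq_coe ht
  have hcard : hfin.toFinset.card = m := by
    rw [hfin.encard_eq_coe_toFinset_card] at ht
    exact_mod_cast ht
  let e := hfin.toFinset.equivFinOfCardEq hcard
  refine ⟨fun a => e.symm a, Subtype.val_injective.comp e.symm.injective,
    fun a => htS (hfin.mem_toFinset.mp (e.symm a).2), ?_⟩
  exact ⟨e ⟨z, hfin.mem_toFinset.mpr (hzt rfl)⟩, by simp⟩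

theorem le_encard_of_injective_fin {α : Type*} {S : Set α} {m : ℕ} {y : Fin m → α}
    (hy : Function.Injective y) (h : ∀ a, y a ∈ S) : (m : ℕ∞) ≤ S.encard := by
  have h1 : (range y).encard = m := by
    rw [← image_univ, hy.encard_image, encard_univ]
    simp
  rw [← h1]
  exact encard_le_encard (range_subset_iff.mpr h)

theorem four_le_encard_of_not_le {α : Type*} {S : Set α} (h : ¬ S.encard ≤ 3) :
    ((4 : ℕ) : ℕ∞) ≤ S.encard := by
  rw [not_le] at h
  exact Order.add_one_le_of_lt h

end Tuples

section Genericity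

variable {F : Type*} [TopologicalSpace F] [ChartedSpace Plane F]

theorem mem_unstablePoints_iff {g : F → Space} (hg : ∀ p, SheetsGeneric g p) {p : Space} :
    p ∈ unstablePoints g ↔ ((4 : ℕ) : ℕ∞) ≤ (g ⁻¹' {p}).encard := by
  constructor
  · intro h
    refine four_le_encard_of_not_le fun h' => h ⟨h', hg p⟩
  · intro h h'
    have := h.trans h'.1
    norm_cast at this

theorem mem_quadImm_zero {g : F → Space} (hg : IsSurfaceImmersion g)
    (hgen : ∀ p, SheetsGeneric g p)
    (h4 : ∀ y : Fin 4 → F, Function.Injective y → ¬ ∀ a b, g (y a) = g (y b)) :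
    g ∈ QuadImm F 0 := by
  have hempty : unstablePoints g = ∅ := by
    rw [eq_empty_iff_forall_notMem]
    intro p hp
    have h := (mem_unstablePoints_iff hgen).mp hp
    have hne : (g ⁻¹' {p}).Nonempty := by
      rw [← encard_pos]
      exact lt_of_lt_of_le (by norm_num) h
    obtain ⟨z, hz⟩ := hne
    obtain ⟨y, hy, hyp, -⟩ := exists_injective_fin_of_le_encard (by norm_num) h hz
    exact h4 y hy fun a b => (hyp a).trans (hyp b).symm
  exact ⟨hg, by simp [hempty], by simp [hempty]⟩

theorem QuadImm.sheetsGeneric {n : ℕ} {g : F → Space} (hg : g ∈ QuadImm F n) (p : Space) :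
    SheetsGeneric g p := by
  by_cases hp : p ∈ unstablePoints g
  · exact (hg.2.2 p hp).2
  · exact (not_not.mp hp).2

theorem eq_zero_of_forall_conormal {g : F → Space}
    (hg : ∀ x, Function.Injective (differential g x)) {p : Space} (hp : SheetsGeneric g p)
    {ι : Type*} [Fintype ι] (hι : 3 ≤ Fintype.card ι) {x : ι → F} (hx : Function.Injective x)
    (hxp : ∀ a, g (x a) = p) {n : F → Covector} (hn : ∀ a, IsConormal g (x a) (n (x a)))
    (hne : ∀ a, n (x a) ≠ 0) {w : Space} (hw : ∀ a, n (x a) w = 0) : w = 0 := by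
  obtain ⟨A, hA, hcard⟩ := Finset.exists_subset_card_eq
    (s := Finset.univ.map ⟨x, hx⟩) (n := 3) (by rwa [Finset.card_map, Finset.card_univ])
  have hmem : ∀ y ∈ A, ∃ a, x a = y := by
    intro y hy
    obtain ⟨a, -, rfl⟩ := Finset.mem_map.mp (hA hy)
    exact ⟨a, rfl⟩
  refine (hp A ?_ hcard.le).eq_zero_of_forall hg hcard (ν := n) ?_ ?_ ?_ <;>
  · intro y hy
    obtain ⟨a, rfl⟩ := hmem y hy
    first
    | exact hxp a
    | exact hn a
    | exact hne a
    | exact hw a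

/-- Closeness to `i` is a convex condition, so segments between deformations stay near `i`
uniformly. -/
theorem C1Close.convexComb {i h h' : F → Space} {ε : ℝ} (hh : C1Close i ε h)
    (hh' : C1Close i ε h') {t : ℝ} (ht : t ∈ Icc (0 : ℝ) 1) :
    C1Close i ε (fun y => (1 - t) • h y + t • h' y) := by
  have h1 : (0 : ℝ) ≤ 1 - t := by linarith [ht.2]
  have hconv : ∀ a b c : Space, ∀ r : ℝ, ‖a - c‖ ≤ r → ‖b - c‖ ≤ r →
      ‖(1 - t) • a + t • b - c‖ ≤ r := by
    intro a b c r ha hb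
    have : (1 - t) • a + t • b - c = (1 - t) • (a - c) + t • (b - c) := by module
    rw [this]
    calc _ ≤ ‖(1 - t) • (a - c)‖ + ‖t • (b - c)‖ := norm_add_le _ _
      _ = (1 - t) * ‖a - c‖ + t * ‖b - c‖ := by
        rw [norm_smul, norm_smul, Real.norm_of_nonneg h1, Real.norm_of_nonneg ht.1]
      _ ≤ (1 - t) * r + t * r := by
        have := ht.1
        gcongr
      _ = r := by ring
  have hd : ∀ y v, differential (fun y => (1 - t) • h y + t • h' y) y v =
      (1 - t) • differential h y v + t • differential h' y v := by
    intro y v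
    have d1 := (hh.smooth.mdifferentiable (by simp) y).hasMFDerivAt
    have d2 := (hh'.smooth.mdifferentiable (by simp) y).hasMFDerivAt
    have := ((d1.const_smul (1 - t)).add (d2.const_smul t)).mfderiv
    exact congrArg (fun L : Plane →L[ℝ] Space => L v) this
  refine ⟨((contMDiff_const (I := 𝓡 2) (I' := 𝓘(ℝ, ℝ)) (M := F) (c := 1 - t)).smul hh.smooth).add
      ((contMDiff_const (I := 𝓡 2) (I' := 𝓘(ℝ, ℝ)) (M := F) (c := t)).smul hh'.smooth), fun y => ?_,
    fun y v => ?_⟩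
  · exact hconv _ _ _ _ (hh.norm_sub_le y) (hh'.norm_sub_le y)
  · rw [hd]
    exact hconv _ _ _ _ (hh.norm_differential_sub_le y v) (hh'.norm_differential_sub_le y v)

variable [IsManifold (𝓡 2) ∞ F] [CompactSpace F]

/-- Pushing the sheet of `i` at `x₀` slightly creates no new multiple points of multiplicity at
least four: these are the old ones, without the sheet at `x₀`. -/
theorem PushesSheet.eventually_fiber_eq {i : F → Space} (hi : IsSurfaceImmersion i)
    (hgen : ∀ p, SheetsGeneric i p) {x₀ : F} {G : ℝ → F → Space} (hG : PushesSheet i x₀ G)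
    (h4 : ∀ p ∈ unstablePoints i, (i ⁻¹' {p} \ {x₀}).encard = 4) :
    ∀ᶠ s in 𝓝[>] (0 : ℝ), IsSurfaceImmersion (G s) ∧ (∀ p, SheetsGeneric (G s) p) ∧
      unstablePoints (G s) = unstablePoints i ∧
      ∀ p ∈ unstablePoints i, G s ⁻¹' {p} = i ⁻¹' {p} \ {x₀} := by
  have hconv := hG.1.convergesC1 hi
  have hne := hG.1.eventually_apply_ne hi hG.2.1
  have hs1 : ∀ᶠ s in 𝓝[>] (0 : ℝ), s ∈ Ioo (0 : ℝ) 1 := Ioo_mem_nhdsGT one_pos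
  have hkey : ∀ᶠ s in 𝓝[>] (0 : ℝ), ∀ y : Fin 4 → F, Function.Injective y →
      (∀ a b, G s (y a) = G s (y b)) → ∀ a, G s (y a) = i (y a) := by
    refine hconv.eventually_forall_tuple hi fun x hx hc => ?_
    have hproj : ∀ a, Tendsto (fun z : ℝ × (Fin 4 → F) => (z.1, z.2 a)) (𝓝[>] 0 ×ˢ 𝓝 x)
        (𝓝[>] 0 ×ˢ 𝓝 (x a)) := fun a =>
      tendsto_fst.prodMk (((continuous_apply a).tendsto x).comp tendsto_snd)
    have hunst : ∀ a, i (x a) ∈ unstablePoints i := fun a =>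
      (mem_unstablePoints_iff hgen).mpr (le_encard_of_injective_fin hx fun b => hc b a)
    have hfix : ∀ᶠ z : ℝ × (Fin 4 → F) in 𝓝[>] 0 ×ˢ 𝓝 x, ∀ a, x a ≠ x₀ →
        G z.1 (z.2 a) = i (z.2 a) := by
      refine eventually_all.mpr fun a => ?_
      by_cases ha : x a = x₀
      · simp [ha]
      · filter_upwards [(hproj a).eventually (tendsto_snd.eventually (hG.2.2 (x a) ha (hunst a))),
          tendsto_fst.eventually hs1] with z hz hz1 _
        exact hz z.1 ⟨hz1.1.le, hz1.2.le⟩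
    -- If the pushed sheet took part in a quadruple point, the three stationary transverse sheets
    -- would force this point to be `i x₀`, by the transversality estimate with `r = 0`. The pushed
    -- sheet misses that point.
    by_cases hx₀ : ∃ a₀, x a₀ = x₀
    · obtain ⟨a₀, rfl⟩ := hx₀
      have hx' : Function.Injective (fun b : {b : Fin 4 // b ≠ a₀} => x b) :=
        hx.comp Subtype.val_injective
      obtain ⟨C, -, hC⟩ := exists_norm_sub_le_of_transverse hi
        (x := fun b : {b : Fin 4 // b ≠ a₀} => x b) (q := i (x a₀)) (fun b => hc b a₀)
        (fun b => isConormal_sheetNormal i (x b))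
        (fun w hw => eq_zero_of_forall_conormal hi.2 (hgen (i (x a₀))) (by simp) hx'
          (fun b => hc b a₀) (n := fun y => innerSL ℝ (sheetNormal i y))
          (fun b => isConormal_sheetNormal i (x b)) (fun b h => by
            have h2 := congrArg (fun φ : Covector => φ (sheetNormal i (x b))) h
            simp only [innerSL_apply_apply, zero_apply, inner_self_eq_zero] at h2
            exact crossNormal_ne_zero (hi.2 (x b)) h2) hw)
      have hrestr : Tendsto (fun z : ℝ × (Fin 4 → F) => fun b : {b : Fin 4 // b ≠ a₀} => z.2 b)
          (𝓝[>] 0 ×ˢ 𝓝 x) (𝓝 fun b : {b : Fin 4 // b ≠ a₀} => x b) :=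
        ((continuous_pi fun b : {b : Fin 4 // b ≠ a₀} =>
          continuous_apply (b : Fin 4)).tendsto x).comp tendsto_snd
      filter_upwards [hfix, hrestr.eventually hC, (hproj a₀).eventually hne] with z h1 h2 h3 _ hzc
      have h5 := h2 (G z.1 (z.2 a₀)) 0 le_rfl fun b => by
        rw [← h1 b fun h => b.2 (hx h), hzc b a₀, sub_self, norm_zero]
      rw [mul_zero, norm_le_zero_iff, sub_eq_zero] at h5
      exact absurd h5 h3
    · push Not at hx₀
      filter_upwards [hfix] with z hz _ _ a
      exact hz a (hx₀ a)
  have hx₀ : ∀ᶠ s in 𝓝[>] (0 : ℝ), G s x₀ ≠ i x₀ := by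
    have : Tendsto (fun s : ℝ => (s, x₀)) (𝓝[>] 0) (𝓝[>] 0 ×ˢ 𝓝 x₀) :=
      tendsto_id.prodMk tendsto_const_nhds
    exact this.eventually hne
  filter_upwards [hkey, hx₀, hs1, hconv.eventually_isSurfaceImmersion hi,
    hconv.eventually_sheetsGeneric hi hgen] with s h1 h2 h3 h5 h6
  have hsub : ∀ p ∈ unstablePoints (G s), G s ⁻¹' {p} ⊆ i ⁻¹' {p} \ {x₀} := by
    intro p hp z hz
    obtain ⟨y, hy, hyp, a, rfl⟩ := exists_injective_fin_of_le_encard (by norm_num)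
      ((mem_unstablePoints_iff h6).mp hp) hz
    have := h1 y hy (fun a b => (hyp a).trans (hyp b).symm) a
    refine ⟨?_, ?_⟩
    · rw [mem_preimage, ← this]
      exact hyp a
    · intro h
      rw [mem_singleton_iff.mp h] at this
      exact h2 this
  have hsup : ∀ p ∈ unstablePoints i, i ⁻¹' {p} \ {x₀} ⊆ G s ⁻¹' {p} := by
    rintro p hp z ⟨hz, hzx⟩
    have hzp : i z = p := hz
    have := (hG.2.2 z hzx (by rwa [hzp])).self_of_nhds s ⟨h3.1.le, h3.2.le⟩
    rw [mem_preimage, this]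
    exact hz
  have hunst : unstablePoints (G s) = unstablePoints i := by
    ext p
    constructor
    · intro hp
      exact (mem_unstablePoints_iff hgen).mpr (((mem_unstablePoints_iff h6).mp hp).trans
        (encard_le_encard ((hsub p hp).trans sdiff_subset)))
    · intro hp
      refine (mem_unstablePoints_iff h6).mpr ?_
      have := encard_le_encard (hsup p hp)
      rw [h4 p hp] at this
      exact_mod_cast this
  exact ⟨h5, h6, hunst, fun p hp => (hsub p (hunst ▸ hp)).antisymm (hsup p hp)⟩

end Genericity

/-! ### Linear homotopies between slight deformations. -/

section QuadrupleSpeed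

variable {F : Type*}

theorem crossingSpeed_eq_sum_of_support_eq {x : Fin 4 → F}
    (hx : Function.Injective x) {l : F →₀ Covector} (hs : l.support = Finset.univ.map ⟨x, hx⟩)
    (H : ℝ → F → Space) (t : ℝ) : crossingSpeed H t l = ∑ a, l (x a) (velocity H t (x a)) := by
  rw [crossingSpeed, Finsupp.sum, hs, Finset.sum_map]
  rfl

end QuadrupleSpeed

section Segments

variable {F : Type*} [TopologicalSpace F] [ChartedSpace Plane F]

/-- A linear homotopy through generic immersions has no unstable points, so the transversality
conditions are vacuous. -/
theorem IsQInvariant.eq_of_segment {f : QuadImm F 0 → ZMod 2} (hf : IsQInvariant f)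
    {h₀ h₁ : F → Space}
    (hseg : ∀ t ∈ Icc (0 : ℝ) 1, (fun y => (1 - t) • h₀ y + t • h₁ y) ∈ QuadImm F 0)
    (m₀ : h₀ ∈ QuadImm F 0) (m₁ : h₁ ∈ QuadImm F 0) : f ⟨h₀, m₀⟩ = f ⟨h₁, m₁⟩ := by
  set H : ℝ → F → Space := fun t y => (1 - t) • h₀ y + t • h₁ y with hH
  have hH0 : H 0 = h₀ := by funext y; simp [hH]
  have hH1 : H 1 = h₁ := by funext y; simp [hH]
  have hempty : ∀ t ∈ Icc (0 : ℝ) 1, unstablePoints (H t) = ∅ := fun t ht => by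
    simpa using (hseg t ht).2.1
  have hsm : ContMDiff (𝓘(ℝ, ℝ).prod (𝓡 2)) 𝓘(ℝ, Space) ∞ (fun z : ℝ × F => H z.1 z.2) :=
    ((contMDiff_const.sub contMDiff_fst).smul (m₀.1.1.comp contMDiff_snd)).add
      (contMDiff_fst.smul (m₁.1.1.comp contMDiff_snd))
  have hgen : IsGenericRegularHomotopy H := by
    refine ⟨⟨hsm.contMDiffOn, fun t ht => (hseg t ht).1⟩, hseg 0 (by simp), hseg 1 (by simp),
      fun t ht => ?_⟩
    rw [hempty t ht]
    exact ⟨subsingleton_empty, fun p hp => absurd hp (notMem_empty p)⟩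
  have hquad : NoQuadruplePoints H := by
    intro t ht p
    have : p ∉ unstablePoints (H t) := by
      rw [hempty t ht]
      exact notMem_empty p
    exact (not_not.mp this).1
  have := hf H hgen hquad (hseg 0 (by simp)) (hseg 1 (by simp))
  convert this using 3
  · exact hH0.symm
  · exact hH1.symm

variable [IsManifold (𝓡 2) ∞ F] [CompactSpace F]

/-- Let `G` and `G'` be deformations of `i` that, at each quadruple of sheets through a point, move
to the same side, or of which the first is stationary and the second moves to one side. Then the
segments joining maps obtained by sufficiently slight deformations `G` and `G'` consist of generic
immersions, with the possible exception of the starting point. -/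
theorem eventually_segment_mem_quadImm {i : F → Space} (hi : IsSurfaceImmersion i)
    (hgen : ∀ p, SheetsGeneric i p) {G G' : ℝ → F → Space} (hG : IsDeformation i G)
    (hG' : IsDeformation i G')
    (hside : ∀ p l, IsConormalRelation i p l → l.support.card = 4 →
      0 < crossingSpeed G 0 l * crossingSpeed G' 0 l ∨
      (crossingSpeed G' 0 l ≠ 0 ∧
        ∀ x ∈ l.support, ∀ᶠ y in 𝓝 x, ∀ s ∈ Icc (0 : ℝ) 1, G s y = i y)) :
    ∀ᶠ z : ℝ × ℝ in 𝓝[>] 0 ×ˢ 𝓝[>] 0, ∀ t ∈ Ioc (0 : ℝ) 1,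
      (fun y => (1 - t) • G z.1 y + t • G' z.2 y) ∈ QuadImm F 0 := by
  refine (eventually_prod_principal_iff (p := fun τ : (ℝ × ℝ) × ℝ =>
    (fun y => (1 - τ.2) • G τ.1.1 y + τ.2 • G' τ.1.2 y) ∈ QuadImm F 0)).mp ?_
  -- The principal filter makes all estimates uniform in the position `t` on the segment, including
  -- `t` close to `0`.
  set 𝓕 : Filter ((ℝ × ℝ) × ℝ) := (𝓝[>] 0 ×ˢ 𝓝[>] 0) ×ˢ 𝓟 (Ioc 0 1) with h𝓕
  set h : (ℝ × ℝ) × ℝ → F → Space := fun τ y => (1 - τ.2) • G τ.1.1 y + τ.2 • G' τ.1.2 y with hh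
  have hp1 : Tendsto (fun τ : (ℝ × ℝ) × ℝ => τ.1.1) 𝓕 (𝓝[>] 0) := tendsto_fst.comp tendsto_fst
  have hp2 : Tendsto (fun τ : (ℝ × ℝ) × ℝ => τ.1.2) 𝓕 (𝓝[>] 0) := tendsto_snd.comp tendsto_fst
  have hp3 : ∀ᶠ τ in 𝓕, τ.2 ∈ Ioc (0 : ℝ) 1 := tendsto_snd.eventually (mem_principal_self _)
  have hs1 : ∀ᶠ s in 𝓝[>] (0 : ℝ), s ∈ Ioo (0 : ℝ) 1 := Ioo_mem_nhdsGT one_pos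
  have hconv : ConvergesC1 𝓕 h i := by
    intro ε hε
    filter_upwards [hp1.eventually (hG.convergesC1 hi ε hε),
      hp2.eventually (hG'.convergesC1 hi ε hε), hp3] with τ h1 h2 h3
    exact h1.convexComb h2 ⟨h3.1.le, h3.2⟩
  have hkey : ∀ᶠ τ in 𝓕, ∀ y : Fin 4 → F, Function.Injective y →
      (∀ a b, h τ (y a) = h τ (y b)) → False := by
    refine hconv.eventually_forall_tuple hi fun x hx hc => ?_
    obtain ⟨l, hl, hls⟩ := exists_isConormalRelation_support_eq hi.2 (hgen (i (x 0)))
      (A := Finset.univ.map ⟨x, hx⟩) (by simp) (by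
        intro y hy
        obtain ⟨a, -, rfl⟩ := Finset.mem_map.mp hy
        exact hc a 0)
    have hmem : ∀ a, x a ∈ l.support := fun a => by
      rw [hls]
      exact Finset.mem_map_of_mem ⟨x, hx⟩ (Finset.mem_univ a)
    have hsum : ∑ a, l (x a) = 0 := by
      have := hl.sum_eq_zero
      rw [Finsupp.sum, hls, Finset.sum_map] at this
      exact this
    have hspan : ∀ w, (∀ a, l (x a) w = 0) → w = 0 := fun w hw =>
      eq_zero_of_forall_conormal hi.2 (hgen (i (x 0))) (by simp) hx (fun a => hc a 0)
        (fun a => hl.conormal (x a)) (fun a => Finsupp.mem_support_iff.mp (hmem a)) hw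
    set V : Fin 4 → Space := fun a => velocity G 0 (x a) with hV
    set V' : Fin 4 → Space := fun a => velocity G' 0 (x a) with hV'
    have hcG : crossingSpeed G 0 l = ∑ a, l (x a) (V a) :=
      crossingSpeed_eq_sum_of_support_eq hx hls G 0
    have hcG' : crossingSpeed G' 0 l = ∑ a, l (x a) (V' a) :=
      crossingSpeed_eq_sum_of_support_eq hx hls G' 0
    set c := crossingSpeed G 0 l with hcdef
    set c' := crossingSpeed G' 0 l with hcdef'
    obtain ⟨M, hM1, hMV, hMV'⟩ : ∃ M : ℝ, 1 ≤ M ∧ (∀ a, ‖V a‖ ≤ M) ∧ ∀ a, ‖V' a‖ ≤ M := by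
      have h1 := norm_nonneg V
      have h2 := norm_nonneg V'
      exact ⟨1 + ‖V‖ + ‖V'‖, by linarith, fun a => by linarith [norm_le_pi_norm V a],
        fun a => by linarith [norm_le_pi_norm V' a]⟩
    have hM0 : 0 < M := by linarith
    have hc' : c' ≠ 0 := by
      rcases hside _ l hl (by rw [hls]; simp) with h1 | h1
      · exact right_ne_zero_of_mul h1.ne'
      · exact h1.1
    -- the displacement of a relation along the segment is bounded below
    obtain ⟨m, hm, hmain⟩ : ∃ m : ℝ, 0 < m ∧ ∀ κ' : ℝ, 0 < κ' →
        ∀ᶠ z : ((ℝ × ℝ) × ℝ) × (Fin 4 → F) in 𝓕 ×ˢ 𝓝 x, ∃ r : ℝ, ∃ d : Fin 4 → Space, 0 < r ∧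
          (∀ a, ‖(h z.1 (z.2 a) - i (z.2 a)) - d a‖ ≤ κ' * r) ∧ (∀ a, ‖d a‖ ≤ M * r) ∧
          m * r ≤ |∑ a, l (x a) (d a)| := by
      have hproj1 : ∀ a, Tendsto (fun z : ((ℝ × ℝ) × ℝ) × (Fin 4 → F) => (z.1.1.1, z.2 a))
          (𝓕 ×ˢ 𝓝 x) (𝓝[>] 0 ×ˢ 𝓝 (x a)) := fun a =>
        (hp1.comp tendsto_fst).prodMk (((continuous_apply a).tendsto x).comp tendsto_snd)
      have hproj2 : ∀ a, Tendsto (fun z : ((ℝ × ℝ) × ℝ) × (Fin 4 → F) => (z.1.1.2, z.2 a))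
          (𝓕 ×ˢ 𝓝 x) (𝓝[>] 0 ×ˢ 𝓝 (x a)) := fun a =>
        (hp2.comp tendsto_fst).prodMk (((continuous_apply a).tendsto x).comp tendsto_snd)
      rcases hside _ l hl (by rw [hls]; simp) with hcc | ⟨-, hfix⟩
      · have hcc : 0 < c * c' := hcc
        have hc0 : c ≠ 0 := left_ne_zero_of_mul hcc.ne'
        refine ⟨min |c| |c'|, lt_min (abs_pos.mpr hc0) (abs_pos.mpr hc'), fun κ' hκ' => ?_⟩
        have e1 := eventually_all.mpr fun a =>
          (hproj1 a).eventually (hG.eventually_norm_sub_le (x a) hκ')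
        have e2 := eventually_all.mpr fun a =>
          (hproj2 a).eventually (hG'.eventually_norm_sub_le (x a) hκ')
        filter_upwards [e1, e2, tendsto_fst.eventually hp3,
          (hp1.comp tendsto_fst).eventually hs1, (hp2.comp tendsto_fst).eventually hs1]
          with ⟨⟨⟨s, s'⟩, t⟩, y⟩ e1 e2 ⟨ht0, ht1⟩ ⟨hs0, _⟩ ⟨hs0', _⟩
        simp only [Function.comp_apply] at e1 e2 ht0 ht1 hs0 hs0'
        have ht1' : 0 ≤ 1 - t := by linarith
        have hr1 : 0 ≤ (1 - t) * s := by positivity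
        have hr2 : 0 < t * s' := by positivity
        -- The scale `r` is the total elapsed deformation time. As `c` and `c'` have the same sign,
        -- the two contributions to the relation cannot cancel.
        refine ⟨(1 - t) * s + t * s', fun a => ((1 - t) * s) • V a + (t * s') • V' a,
          by positivity, fun a => ?_, fun a => ?_, ?_⟩
        · have : h ((s, s'), t) (y a) - i (y a) - (((1 - t) * s) • V a + (t * s') • V' a) =
              (1 - t) • (G s (y a) - i (y a) - s • V a) +
                t • (G' s' (y a) - i (y a) - s' • V' a) := by
            simp only [hh]
            module
          change ‖h ((s, s'), t) (y a) - i (y a) - (((1 - t) * s) • V a + (t * s') • V' a)‖ ≤ _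
          rw [this]
          calc _ ≤ ‖(1 - t) • (G s (y a) - i (y a) - s • V a)‖ +
                ‖t • (G' s' (y a) - i (y a) - s' • V' a)‖ := norm_add_le _ _
            _ ≤ (1 - t) * (κ' * s) + t * (κ' * s') := by
              rw [norm_smul, norm_smul, Real.norm_of_nonneg ht1', Real.norm_of_nonneg ht0.le]
              gcongr
              exacts [e1 a, e2 a]
            _ = _ := by ring
        · calc _ ≤ ‖((1 - t) * s) • V a‖ + ‖(t * s') • V' a‖ := norm_add_le _ _
            _ ≤ ((1 - t) * s) * M + (t * s') * M := by
              rw [norm_smul, norm_smul, Real.norm_of_nonneg hr1, Real.norm_of_nonneg hr2.le]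
              gcongr
              exacts [hMV a, hMV' a]
            _ = _ := by ring
        · have : ∑ a, l (x a) (((1 - t) * s) • V a + (t * s') • V' a) =
              (1 - t) * s * c + t * s' * c' := by
            rw [hcG, hcG', Finset.mul_sum, Finset.mul_sum, ← Finset.sum_add_distrib]
            refine Finset.sum_congr rfl fun a _ => ?_
            simp only [map_add, map_smul, smul_eq_mul]
          rw [this]
          have h1 : min |c| |c'| ≤ |c| := min_le_left _ _
          have h2 : min |c| |c'| ≤ |c'| := min_le_right _ _
          have h3 : |(1 - t) * s * c + t * s' * c'| = (1 - t) * s * |c| + t * s' * |c'| := by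
            rcases lt_or_gt_of_ne hc0 with hneg | hpos
            · have hneg' : c' < 0 := by nlinarith
              rw [abs_of_neg hneg, abs_of_neg hneg', abs_of_nonpos (by nlinarith)]
              ring
            · have hpos' : 0 < c' := by nlinarith
              rw [abs_of_pos hpos, abs_of_pos hpos', abs_of_nonneg (by positivity)]
          rw [h3]
          nlinarith
      · refine ⟨|c'|, abs_pos.mpr hc', fun κ' hκ' => ?_⟩
        have e1 := eventually_all.mpr fun a =>
          (hproj1 a).eventually (tendsto_snd.eventually (hfix (x a) (hmem a)))
        have e2 := eventually_all.mpr fun a =>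
          (hproj2 a).eventually (hG'.eventually_norm_sub_le (x a) hκ')
        filter_upwards [e1, e2, tendsto_fst.eventually hp3,
          (hp1.comp tendsto_fst).eventually hs1, (hp2.comp tendsto_fst).eventually hs1]
          with ⟨⟨⟨s, s'⟩, t⟩, y⟩ e1 e2 ⟨ht0, ht1⟩ ⟨hs0, hs1⟩ ⟨hs0', _⟩
        simp only [Function.comp_apply] at e1 e2 ht0 ht1 hs0 hs1 hs0'
        have hr2 : 0 < t * s' := by positivity
        -- Here `G` does not move these sheets, so the displacement comes from `G'` alone. The scale
        -- vanishes at `t = 0`, where the quadruple point is still present, but all errors are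
        -- proportional to it.
        refine ⟨t * s', fun a => (t * s') • V' a, hr2, fun a => ?_, fun a => ?_, ?_⟩
        · have : h ((s, s'), t) (y a) - i (y a) - (t * s') • V' a =
              t • (G' s' (y a) - i (y a) - s' • V' a) := by
            simp only [hh, e1 a s ⟨hs0.le, hs1.le⟩]
            module
          change ‖h ((s, s'), t) (y a) - i (y a) - (t * s') • V' a‖ ≤ _
          rw [this, norm_smul, Real.norm_of_nonneg ht0.le]
          calc _ ≤ t * (κ' * s') := by
                gcongr
                exact e2 a
            _ = _ := by ring
        · rw [norm_smul, Real.norm_of_nonneg hr2.le, mul_comm M]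
          gcongr
          exact hMV' a
        · have : ∑ a, l (x a) ((t * s') • V' a) = t * s' * c' := by
            rw [hcG', Finset.mul_sum]
            refine Finset.sum_congr rfl fun a _ => ?_
            simp only [map_smul, smul_eq_mul]
          rw [this, abs_mul, abs_of_pos hr2, mul_comm]
    -- The choice of `κ` bounds the relation on the displacement by `m * r / 2`, against the lower
    -- bound `m * r`.
    obtain ⟨κ', hκ', hdisp⟩ := exists_abs_sum_le_of_displaced hi (fun a => hc a 0)
      (fun a => hl.conormal (x a)) hsum hspan (κ := m / (2 * M)) (by positivity)
    filter_upwards [hmain (κ' * M) (by positivity), tendsto_snd.eventually hdisp]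
      with z h1 h2 _ hzc
    obtain ⟨r, d, hr, hd1, hd2, hd3⟩ := h1
    have h5 := h2 (fun a => h z.1 (z.2 a) - i (z.2 a)) d (M * r) (by positivity)
      (fun a b => by rw [add_sub_cancel, add_sub_cancel, hzc a b])
      (fun a => by rw [← mul_assoc]; exact hd1 a) hd2
    have h6 : m / (2 * M) * (M * r) = m * r / 2 := by field_simp
    rw [h6] at h5
    nlinarith [mul_pos hm hr]
  filter_upwards [hkey, hconv.eventually_isSurfaceImmersion hi,
    hconv.eventually_sheetsGeneric hi hgen] with τ h1 h2 h3
  exact mem_quadImm_zero h2 h3 h1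

end Segments

/-! ### Signs and the telescoping sum over walls. -/

section Signs

/-- The sign encoded by a Boolean. -/
def boolSign (b : Bool) : ℝ := if b then 1 else -1

theorem boolSign_mul_self (b : Bool) : boolSign b * boolSign b = 1 := by
  cases b <;> simp [boolSign]

theorem mul_pos_of_boolSign_mul_pos {b : Bool} {u v : ℝ} (hu : 0 < boolSign b * u)
    (hv : 0 < boolSign b * v) : 0 < u * v := by
  have h1 := mul_pos hu hv
  have h2 : boolSign b * u * (boolSign b * v) = boolSign b * boolSign b * (u * v) := by ring
  rwa [h2, boolSign_mul_self, one_mul] at h1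

theorem boolSign_decide_mul_pos {u : ℝ} (hu : u ≠ 0) : 0 < boolSign (decide (0 < u)) * u := by
  rcases lt_or_gt_of_ne hu with h | h
  · simp [boolSign, not_lt.mpr h.le, h]
  · simp [boolSign, h]

theorem decide_eq_of_boolSign_mul_pos {b : Bool} {u : ℝ} (hu : 0 < boolSign b * u) :
    decide (0 < u) = b := by
  cases b
  · simp only [boolSign, Bool.false_eq_true, if_false] at hu
    simp only [decide_eq_false_iff_not, not_lt]
    linarith
  · simp only [boolSign, if_true] at hu
    simp only [decide_eq_true_eq]
    linarith

theorem ne_zero_of_boolSign_mul_pos {b : Bool} {u : ℝ} (hu : 0 < boolSign b * u) : u ≠ 0 :=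
  right_ne_zero_of_mul hu.ne'

/-- The sum of the values of `g` on both sides of all the walls crossed along a line. -/
theorem sum_add_filter_le_eq {ι α : Type*} [DecidableEq ι] [LinearOrder α] {m : ι → α}
    (hm : Function.Injective m) (g : Finset ι → ZMod 2) (S : Finset ι) :
    ∑ a ∈ S, (g {b ∈ S | m b < m a} + g {b ∈ S | m b ≤ m a}) = g ∅ + g S := by
  -- Adding a largest element `a` leaves the earlier terms unchanged and adds `g s + g (insert a
  -- s)`; the two copies of `g s` cancel modulo 2.
  induction S using Finset.induction_on_max_value m with
  | empty => simp [CharTwo.add_self_eq_zero]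
  | insert a s has hmax ih =>
    have hlt : ∀ b ∈ s, m b < m a := fun b hb =>
      lt_of_le_of_ne (hmax b hb) fun h => has (hm h ▸ hb)
    have h1 : ({b ∈ insert a s | m b < m a} : Finset ι) = s := by
      rw [Finset.filter_insert, if_neg (lt_irrefl _), Finset.filter_true_of_mem hlt]
    have h2 : ({b ∈ insert a s | m b ≤ m a} : Finset ι) = insert a s := by
      rw [Finset.filter_insert, if_pos le_rfl, Finset.filter_true_of_mem hmax]
    have h3 : ∀ c ∈ s, g {b ∈ insert a s | m b < m c} + g {b ∈ insert a s | m b ≤ m c} =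
        g {b ∈ s | m b < m c} + g {b ∈ s | m b ≤ m c} := by
      intro c hc
      rw [Finset.filter_insert, Finset.filter_insert, if_neg (hlt c hc).not_gt,
        if_neg (hlt c hc).not_ge]
    rw [Finset.sum_insert has, Finset.sum_congr rfl h3, ih, h1, h2]
    linear_combination CharTwo.add_self_eq_zero (g s)

end Signs

/-! ### Values on sign patterns and the extension of a `q`-invariant. -/

section SameSides

variable {F : Type*} [TopologicalSpace F] [ChartedSpace Plane F]

theorem mem_unstablePoints_of_isConormalRelation {i : F → Space} (hgen : ∀ p, SheetsGeneric i p)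
    {p : Space} {l : F →₀ Covector} (hl : IsConormalRelation i p l) (hcard : l.support.card = 4) :
    p ∈ unstablePoints i := by
  refine (mem_unstablePoints_iff hgen).mpr ?_
  rw [← hcard, ← encard_coe_eq_coe_finsetCard]
  exact encard_le_encard fun x hx => hl.mem_fiber x hx

theorem IsGenericMultiplePoint.exists_isConormalRelation {i : F → Space}
    (hi : IsSurfaceImmersion i) {p : Space} (hp : IsGenericMultiplePoint 4 i p) :
    ∃ l, IsConormalRelation i p l ∧ l ≠ 0 := by
  have hfin : (i ⁻¹' {p}).Finite := finite_of_encard_eq_coe hp.1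
  have hcard : hfin.toFinset.card = 4 := by
    have := hp.1
    rw [hfin.encard_eq_coe_toFinset_card] at this
    exact_mod_cast this
  obtain ⟨l, hl, hs⟩ := exists_isConormalRelation_support_eq hi.2 hp.2 hcard
    fun x hx => by simpa using hx
  refine ⟨l, hl, ?_⟩
  rintro rfl
  rw [← hs] at hcard
  simp at hcard

theorem IsGenericMultiplePoint.exists_smul_eq {i : F → Space} (hi : IsSurfaceImmersion i)
    {p : Space} (hp : IsGenericMultiplePoint 4 i p) {l l' : F →₀ Covector}
    (hl : IsConormalRelation i p l) (hl0 : l ≠ 0) (hl' : IsConormalRelation i p l') :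
    ∃ c : ℝ, l' = c • l := by
  have hfin : (i ⁻¹' {p}).Finite := finite_of_encard_eq_coe hp.1
  have hcard : hfin.toFinset.card = 4 := by
    have := hp.1
    rw [hfin.encard_eq_coe_toFinset_card] at this
    exact_mod_cast this
  exact hl.exists_smul_eq hi.2 hp.2 hl' hl0 hcard
    (fun x hx => by simpa using hl.mem_fiber x hx) (fun x hx => by simpa using hl'.mem_fiber x hx)

/-- Relations depend only on germs of the sheets, so those of stationary sheets carry over to the
pushed map. -/
theorem IsConormalRelation.of_eventuallyEq {i j : F → Space} {p : Space} {l : F →₀ Covector}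
    (hl : IsConormalRelation i p l) (h : ∀ x ∈ l.support, j =ᶠ[𝓝 x] i) :
    IsConormalRelation j p l where
  mem_fiber x hx := by rw [(h x hx).self_of_nhds, hl.mem_fiber x hx]
  conormal x := by
    by_cases hx : x ∈ l.support
    · intro v
      have : differential j x = differential i x := (h x hx).mfderiv_eq
      rw [this]
      exact hl.conormal x v
    · rw [Finsupp.notMem_support_iff.mp hx]
      exact IsConormal.zero j x
  sum_eq_zero := hl.sum_eq_zero

variable [IsManifold (𝓡 2) ∞ F] [CompactSpace F]

/-- Slight deformations of `i` to the same side at each quadruple of sheets through a point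
produce generic immersions at which a `q`-invariant has the same value. -/
theorem IsQInvariant.eventually_eq_of_same_sides {f : QuadImm F 0 → ZMod 2} (hf : IsQInvariant f)
    {i : F → Space} (hi : IsSurfaceImmersion i) (hgen : ∀ p, SheetsGeneric i p)
    {G G' : ℝ → F → Space} (hG : IsDeformation i G) (hG' : IsDeformation i G')
    (hside : ∀ p l, IsConormalRelation i p l → l.support.card = 4 →
      0 < crossingSpeed G 0 l * crossingSpeed G' 0 l) :
    ∀ᶠ z : ℝ × ℝ in 𝓝[>] 0 ×ˢ 𝓝[>] 0, ∃ (h : G z.1 ∈ QuadImm F 0) (h' : G' z.2 ∈ QuadImm F 0),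
      f ⟨G z.1, h⟩ = f ⟨G' z.2, h'⟩ := by
  have h1 := eventually_segment_mem_quadImm hi hgen hG hG'
    fun p l hl hc => Or.inl (hside p l hl hc)
  -- The segment statement omits its starting point; exchanging the two deformations supplies it.
  have h2 := eventually_segment_mem_quadImm hi hgen hG' hG
    fun p l hl hc => Or.inl (by rw [mul_comm]; exact hside p l hl hc)
  filter_upwards [h1, Filter.tendsto_prod_swap.eventually h2] with z h1 h2
  have e1 := h1 1 (by simp)
  have e2 := h2 1 (by simp)
  simp only [sub_self, zero_smul, one_smul, zero_add, Prod.fst_swap, Prod.snd_swap] at e1 e2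
  refine ⟨e2, e1, hf.eq_of_segment (fun t ht => ?_) e2 e1⟩
  rcases ht.1.eq_or_lt with rfl | h0
  · simpa using e2
  · exact h1 t ⟨h0, ht.2⟩

/-- A `q`-invariant assigns a value to each pattern of signs of the displacement at the
quadruples of sheets through a point. -/
theorem IsQInvariant.exists_pattern_value {f : QuadImm F 0 → ZMod 2} (hf : IsQInvariant f)
    {i : F → Space} (hi : IsSurfaceImmersion i) (hgen : ∀ p, SheetsGeneric i p)
    {K : Type*} {rel : K → F →₀ Covector}
    (hrel : ∀ p l, IsConormalRelation i p l → l.support.card = 4 →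
      ∃ (κ : K) (c : ℝ), c ≠ 0 ∧ l = c • rel κ) (τ : K → Bool) :
    ∃ w : ZMod 2, ∀ G, IsDeformation i G → (∀ κ, 0 < boolSign (τ κ) * crossingSpeed G 0 (rel κ)) →
      ∀ᶠ s in 𝓝[>] (0 : ℝ), ∃ h : G s ∈ QuadImm F 0, f ⟨G s, h⟩ = w := by
  have key : ∀ G, IsDeformation i G → (∀ κ, 0 < boolSign (τ κ) * crossingSpeed G 0 (rel κ)) →
      ∀ G', IsDeformation i G' → (∀ κ, 0 < boolSign (τ κ) * crossingSpeed G' 0 (rel κ)) →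
      ∀ᶠ s in 𝓝[>] (0 : ℝ), ∀ᶠ s' in 𝓝[>] (0 : ℝ),
        ∃ (h : G s ∈ QuadImm F 0) (h' : G' s' ∈ QuadImm F 0), f ⟨G s, h⟩ = f ⟨G' s', h'⟩ := by
    intro G hG hGτ G' hG' hGτ'
    refine (hf.eventually_eq_of_same_sides hi hgen hG hG' fun p l hl hc => ?_).curry
    obtain ⟨κ, c, hc0, rfl⟩ := hrel p l hl hc
    rw [crossingSpeed_smul, crossingSpeed_smul]
    have h1 := mul_pos_of_boolSign_mul_pos (hGτ κ) (hGτ' κ)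
    have h2 : 0 < c * c := mul_self_pos.mpr hc0
    nlinarith [mul_pos h2 h1]
  by_cases hex : ∃ G, IsDeformation i G ∧
      ∀ κ, 0 < boolSign (τ κ) * crossingSpeed G 0 (rel κ)
  · obtain ⟨G₀, hG₀, hGτ₀⟩ := hex
    obtain ⟨s₀, hs₀⟩ := (key G₀ hG₀ hGτ₀ G₀ hG₀ hGτ₀).exists
    obtain ⟨_, h0, _, _⟩ := hs₀.exists
    refine ⟨f ⟨G₀ s₀, h0⟩, fun G hG hGτ => ?_⟩
    filter_upwards [key G hG hGτ G₀ hG₀ hGτ₀] with s hs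
    -- Both `G s` and `G₀ s₀` are compared with the same later choice `G₀ s'`.
    obtain ⟨s', ⟨h1, h2, h3⟩, ⟨h4, h5, h6⟩⟩ := (hs.and hs₀).exists
    exact ⟨h1, h3.trans h6.symm⟩
  -- A pattern that no deformation realises, such as one that is not a sector, gets an arbitrary
  -- value.
  · exact ⟨0, fun G hG hGτ => absurd ⟨G, hG, hGτ⟩ hex⟩

/-- The extension of a `q`-invariant is the sum of its values at resolutions to all sides. -/
theorem IsQInvariant.hasExtensionValue {f : QuadImm F 0 → ZMod 2} (hf : IsQInvariant f)
    {j : F → Space} {n : ℕ} (hj : j ∈ QuadImm F n) {U : Set Space} [Fintype U]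
    [DecidableEq U] (hU : unstablePoints j = U) {rel : U → F →₀ Covector}
    (hrel : ∀ q : U, IsConormalRelation j q (rel q)) (hrel0 : ∀ q, rel q ≠ 0)
    {R : (U → Bool) → ℝ → F → Space} (hR : ∀ σ, IsDeformation j (R σ))
    (hRσ : ∀ σ q, 0 < boolSign (σ q) * crossingSpeed (R σ) 0 (rel q)) {W : (U → Bool) → ZMod 2}
    (hW : ∀ σ, ∀ᶠ s in 𝓝[>] (0 : ℝ), ∃ h : R σ s ∈ QuadImm F 0, f ⟨R σ s, h⟩ = W σ) :
    HasExtensionValue f j (∑ σ, W σ) := by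
  subst hU
  have hspan : ∀ q (hq : q ∈ unstablePoints j) l, IsConormalRelation j q l →
      ∃ c : ℝ, l = c • rel ⟨q, hq⟩ := fun q hq l hl =>
    (hj.2.2 q hq).exists_smul_eq hj.1 (hrel ⟨q, hq⟩) (hrel0 _) hl
  have hpos : ∀ G G' : ℝ → F → Space,
      (∀ q, 0 < crossingSpeed G 0 (rel q) * crossingSpeed G' 0 (rel q)) →
      ∀ q ∈ unstablePoints j, ∀ l, IsConormalRelation j q l → l ≠ 0 →
        0 < crossingSpeed G 0 l * crossingSpeed G' 0 l := by
    intro G G' h q hq l hl hl0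
    obtain ⟨c, rfl⟩ := hspan q hq l hl
    have hc : c ≠ 0 := by
      rintro rfl
      exact hl0 (zero_smul _ _)
    rw [crossingSpeed_smul, crossingSpeed_smul]
    have h2 : 0 < c * c := mul_self_pos.mpr hc
    nlinarith [mul_pos h2 (h ⟨q, hq⟩)]
  have hRres : ∀ σ, IsResolution j (R σ) := fun σ => ⟨hR σ, fun q hq l hl hl0 =>
    left_ne_zero_of_mul (hpos (R σ) (R σ) (fun q => mul_pos_of_boolSign_mul_pos (hRσ σ q)
      (hRσ σ q)) q hq l hl hl0).ne'⟩
  have hne : ∀ (G : Resolution j) q, crossingSpeed G.1 0 (rel q) ≠ 0 := fun G q =>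
    G.2.2 q q.2 (rel q) (hrel q) (hrel0 q)
  let φ : ResolutionKind j → (unstablePoints j → Bool) :=
    Quotient.lift (fun (G : Resolution j) q => decide (0 < crossingSpeed G.1 0 (rel q))) (by
      intro G G' h
      funext q
      have h1 : 0 < crossingSpeed G.1 0 (rel q) * crossingSpeed G'.1 0 (rel q) :=
        h q q.2 (rel q) (hrel q) (hrel0 q)
      refine decide_eq_decide.mpr ⟨fun h2 => (pos_iff_pos_of_mul_pos h1).mp h2,
        fun h2 => (pos_iff_pos_of_mul_pos h1).mpr h2⟩)
  have hφ : ∀ (G : Resolution j) q, 0 < boolSign (φ G.kind q) * crossingSpeed G.1 0 (rel q) :=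
    fun G q => boolSign_decide_mul_pos (hne G q)
  -- The relations at each quadruple point form a line, so the signs on `rel` determine the kind;
  -- the `R σ` realise every choice of signs.
  have hbij : Function.Bijective φ := by
    constructor
    · intro τ τ'
      refine Quotient.inductionOn₂ τ τ' fun G G' h => Quotient.sound ?_
      refine hpos G.1 G'.1 fun q => mul_pos_of_boolSign_mul_pos (hφ G q) ?_
      have : φ G.kind = φ G'.kind := h
      rw [this]
      exact hφ G' q
    · intro σ
      exact ⟨Resolution.kind ⟨R σ, hRres σ⟩,
        funext fun q => decide_eq_of_boolSign_mul_pos (hRσ σ q)⟩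
  let e := Equiv.ofBijective φ hbij
  have hcard : Fintype.card (unstablePoints j) = n := by
    have := hj.2.1
    rw [← coe_toFinset (unstablePoints j), encard_coe_eq_coe_finsetCard, toFinset_card] at this
    exact_mod_cast this
  refine ⟨n, hj, ?_, fun τ => W (φ τ), fun G => ?_, ?_⟩
  · rw [Nat.card_congr e, Nat.card_eq_fintype_card, Fintype.card_fun, Fintype.card_bool, hcard]
  · have hgen := QuadImm.sheetsGeneric hj
    have h1 := (hf.eventually_eq_of_same_sides hj.1 hgen G.2.1 (hR (φ G.kind))
      fun p l hl hc => hpos G.1 (R (φ G.kind))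
        (fun q => mul_pos_of_boolSign_mul_pos (hφ G q) (hRσ _ q)) p
        (mem_unstablePoints_of_isConormalRelation hgen hl hc) l hl (by
          rintro rfl
          simp at hc)).curry
    filter_upwards [h1] with s hs
    obtain ⟨s', ⟨h2, h3, h5⟩, ⟨h6, h7⟩⟩ := (hs.and (hW (φ G.kind))).exists
    exact ⟨h2, h5.trans h7⟩
  · rw [← finsum_eq_sum_of_fintype]
    exact finsum_comp_equiv e

end SameSides

/-! ### The plane of displacements, its walls and sectors. -/

section Walls

/-- The positive side of the walls, on the side `b` of the wall `k`, next to the ray of direction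
`e` in the wall `k`. -/
noncomputable def wallSide (m : Fin 5 → ℝ) (k : Fin 5) (e : ℝ) (b : Bool) : Finset (Fin 5) :=
  Finset.univ.filter fun a => if a = k then b = true else 0 < e * (m k - m a)

theorem wallSide_of_pos {m : Fin 5 → ℝ} (hm : Function.Injective m) (k : Fin 5) {e : ℝ}
    (he : 0 < e) : wallSide m k e false = ({a | m a < m k} : Finset (Fin 5)) ∧
      wallSide m k e true = ({a | m a ≤ m k} : Finset (Fin 5)) := by
  constructor
  · refine Finset.filter_congr fun a _ => ?_
    split_ifs with h
    · simp [h]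
    · rw [mul_pos_iff_of_pos_left he, sub_pos]
  · refine Finset.filter_congr fun a _ => ?_
    split_ifs with h
    · simp [h]
    · rw [mul_pos_iff_of_pos_left he, sub_pos]
      exact ⟨le_of_lt, fun h' => lt_of_le_of_ne h' (hm.ne h)⟩

/-- Reversing a ray amounts to reversing the order of the walls, which reduces one half-plane to the
other. -/
theorem wallSide_neg (m : Fin 5 → ℝ) (k : Fin 5) (e : ℝ) (b : Bool) :
    wallSide m k e b = wallSide (-m) k (-e) b := by
  refine Finset.filter_congr fun a _ => ?_
  simp only [Pi.neg_apply]
  rw [show -e * (-m k - -m a) = e * (m k - m a) by ring]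

/-- Crossing the five rays of one half-plane in the order of `m` switches one wall after another.
Only the two extreme sectors survive, and the opposite half-plane has the same two. -/
theorem sum_wallSide_of_pos {m : Fin 5 → ℝ} (hm : Function.Injective m) {e : Fin 5 → ℝ}
    (he : ∀ k, 0 < e k) (g : Finset (Fin 5) → ZMod 2) :
    ∑ k, ∑ b, g (wallSide m k (e k) b) = g ∅ + g Finset.univ := by
  rw [← sum_add_filter_le_eq hm g Finset.univ]
  refine Finset.sum_congr rfl fun k _ => ?_
  rw [Fintype.sum_bool, (wallSide_of_pos hm k (he k)).1, (wallSide_of_pos hm k (he k)).2, add_comm]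

/-- The walls cut the plane into sectors, each of which is adjacent to two of the ten rays. -/
theorem sum_wallSide_eq_zero {m : Fin 5 → ℝ} (hm : Function.Injective m)
    {e : Fin 5 → Fin 2 → ℝ} (he : ∀ k, e k 0 * e k 1 < 0) (g : Finset (Fin 5) → ZMod 2) :
    ∑ k, ∑ l, ∑ b, g (wallSide m k (e k l) b) = 0 := by
  have hpos : ∀ k (u : ℝ), 0 < u → ∀ b, wallSide m k u b = wallSide m k 1 b := by
    intro k u hu b
    cases b
    · rw [(wallSide_of_pos hm k hu).1, (wallSide_of_pos hm k one_pos).1]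
    · rw [(wallSide_of_pos hm k hu).2, (wallSide_of_pos hm k one_pos).2]
  have hm' : Function.Injective (-m) := neg_injective.comp hm
  have hneg : ∀ k (u : ℝ), u < 0 → ∀ b, wallSide m k u b = wallSide (-m) k 1 b := by
    intro k u hu b
    have hu' : 0 < -u := by linarith
    rw [wallSide_neg]
    cases b
    · rw [(wallSide_of_pos hm' k hu').1, (wallSide_of_pos hm' k one_pos).1]
    · rw [(wallSide_of_pos hm' k hu').2, (wallSide_of_pos hm' k one_pos).2]
  have h1 : ∀ k, ∑ l, ∑ b, g (wallSide m k (e k l) b) =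
      ∑ b, g (wallSide m k 1 b) + ∑ b, g (wallSide (-m) k 1 b) := by
    intro k
    rw [Fin.sum_univ_two]
    rcases mul_neg_iff.mp (he k) with ⟨h0, h1⟩ | ⟨h0, h1⟩
    · simp only [hpos k _ h0, hneg k _ h1]
    · simp only [hpos k _ h1, hneg k _ h0]
      rw [add_comm]
  rw [Finset.sum_congr rfl fun k _ => h1 k, Finset.sum_add_distrib,
    sum_wallSide_of_pos hm (fun _ => one_pos), sum_wallSide_of_pos hm' (fun _ => one_pos),
    CharTwo.add_self_eq_zero]

theorem exists_displacement_wallSide {m : Fin 5 → ℝ} (hm : Function.Injective m) (k : Fin 5)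
    {e : ℝ} (he : e ≠ 0) (b : Bool) :
    ∃ ρ : Fin 5 → ℝ, ∀ a,
      0 < boolSign (decide (a ∈ wallSide m k e b)) * ∑ j, (m j - m a) * ρ j := by
  obtain ⟨k', hk'⟩ : ∃ k' : Fin 5, k' ≠ k := exists_ne k
  have hne : ∀ a, a ≠ k → e * (m k - m a) ≠ 0 := fun a ha =>
    mul_ne_zero he (sub_ne_zero.mpr (hm.ne ha.symm))
  obtain ⟨θ, hθ, hθ0⟩ : ∃ θ : ℝ, (∀ a, a ≠ k → θ < |e * (m k - m a)|) ∧ 0 < θ := by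
    have h1 : ∀ᶠ θ in 𝓝[>] (0 : ℝ), ∀ a, a ≠ k → θ < |e * (m k - m a)| := by
      refine eventually_all.mpr fun a => ?_
      by_cases ha : a = k
      · simp [ha]
      · filter_upwards [Ioo_mem_nhdsGT (abs_pos.mpr (hne a ha))] with θ hθ _
        exact hθ.2
    exact (h1.and self_mem_nhdsWithin).exists
  -- Transferring `t` from sheet `k` to sheet `k'` keeps the total displacement `e` and shifts the
  -- coordinates of all five walls by the same amount `θ * boolSign b`. This leaves the wall `k` on
  -- the side `b` and, as `θ` is small, crosses no other wall.
  set t := θ * boolSign b / (m k' - m k) with ht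
  have hkk : m k' - m k ≠ 0 := sub_ne_zero.mpr (hm.ne hk')
  refine ⟨Pi.single k (e - t) + Pi.single k' t, fun a => ?_⟩
  have hsum : ∑ j, (m j - m a) * (Pi.single k (e - t) + Pi.single k' t : Fin 5 → ℝ) j =
      e * (m k - m a) + θ * boolSign b := by
    simp only [Pi.add_apply, mul_add, Finset.sum_add_distrib, Pi.single_apply, mul_ite, mul_zero,
      Finset.sum_ite_eq', Finset.mem_univ, if_true]
    have : t * (m k' - m k) = θ * boolSign b := by rw [ht]; field_simp
    linear_combination this
  rw [hsum]
  have hmem : a ∈ wallSide m k e b ↔ if a = k then b = true else 0 < e * (m k - m a) := by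
    simp only [wallSide, Finset.mem_filter, Finset.mem_univ, true_and]
  by_cases ha : a = k
  · subst ha
    simp only [if_true] at hmem
    rw [show decide (a ∈ wallSide m a e b) = b by simp [hmem]]
    have : boolSign b * (e * (m a - m a) + θ * boolSign b) = θ * (boolSign b * boolSign b) := by
      ring
    rw [this, boolSign_mul_self]
    linarith
  · simp only [ha, if_false] at hmem
    have h1 := hθ a ha
    have h2 : |θ * boolSign b| = θ := by
      rw [abs_mul, abs_of_pos hθ0]
      cases b <;> simp [boolSign]
    have h3 := neg_abs_le (θ * boolSign b)
    have h4 := le_abs_self (θ * boolSign b)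
    rw [h2] at h3 h4
    rcases lt_or_gt_of_ne (hne a ha) with hlt | hgt
    · rw [abs_of_neg hlt] at h1
      rw [show decide (a ∈ wallSide m k e b) = false by simp [hmem, hlt.le]]
      simp only [boolSign, Bool.false_eq_true, if_false] at h1 h3 h4 ⊢
      linarith
    · rw [abs_of_pos hgt] at h1
      rw [show decide (a ∈ wallSide m k e b) = true by simp [hmem, hgt]]
      simp only [boolSign, if_true] at h1 h3 h4 ⊢
      linarith

end Walls

/-! ### Relations at the quintuple point and prescribed displacements. -/

section OmitRelation

variable {F : Type*}

theorem Covector.exists_apply_eq_one {μ : Covector} (hμ : μ ≠ 0) : ∃ u, μ u = 1 := by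
  obtain ⟨v, hv⟩ : ∃ v, μ v ≠ 0 := by
    by_contra! h
    exact hμ (ContinuousLinearMap.ext h)
  exact ⟨(μ v)⁻¹ • v, by rw [map_smul, smul_eq_mul, inv_mul_cancel₀ hv]⟩

/-- The relation among the conormals at a quintuple point that omits the sheet `a`. -/
noncomputable def omitRelation {x : Fin 5 → F} (hx : Function.Injective x)
    (ν : Fin 5 → Covector) (m : Fin 5 → ℝ) (a : Fin 5) : F →₀ Covector :=
  conormalFamily hx fun k => (m k - m a) • ν k

theorem crossingSpeed_omitRelation {x : Fin 5 → F} (hx : Function.Injective x)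
    {ν : Fin 5 → Covector} {m : Fin 5 → ℝ} (a : Fin 5)
    (H : ℝ → F → Space) (t : ℝ) : crossingSpeed H t (omitRelation hx ν m a) =
      ∑ k, (m k - m a) * ν k (velocity H t (x k)) := by
  rw [omitRelation, crossingSpeed_conormalFamily]
  rfl

end OmitRelation

section QuintupleRelations

variable {F : Type*} [TopologicalSpace F] [ChartedSpace Plane F]

/-- The conormals `ν k` of the sheets of `i` at the points `x k`, satisfying the two relations
`∑ ν k = 0` and `∑ m k • ν k = 0` with distinct `m k`. -/
structure IsQuintupleConormals (i : F → Space) (x : Fin 5 → F) (ν : Fin 5 → Covector)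
    (m : Fin 5 → ℝ) : Prop where
  injective : Function.Injective m
  conormal : ∀ k, IsConormal i (x k) (ν k)
  ne_zero : ∀ k, ν k ≠ 0
  sum_eq_zero : ∑ k, ν k = 0
  sum_smul_eq_zero : ∑ k, m k • ν k = 0

variable {i : F → Space} {x : Fin 5 → F} {ν : Fin 5 → Covector} {m : Fin 5 → ℝ}

theorem IsQuintupleConormals.isConormalRelation (h : IsQuintupleConormals i x ν m)
    (hx : Function.Injective x) {p : Space} (hxp : ∀ k, i (x k) = p) (a : Fin 5) :
    IsConormalRelation i p (omitRelation hx ν m a) := by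
  refine isConormalRelation_conormalFamily hx hxp (fun k => (h.conormal k).smul _) ?_
  have : ∀ k, (m k - m a) • ν k = m k • ν k - m a • ν k := fun k => by module
  rw [Finset.sum_congr rfl fun k _ => this k, Finset.sum_sub_distrib, ← Finset.smul_sum,
    h.sum_eq_zero, h.sum_smul_eq_zero, smul_zero, sub_zero]

theorem IsQuintupleConormals.mem_support (h : IsQuintupleConormals i x ν m)
    (hx : Function.Injective x) (a : Fin 5) (y : F) :
    y ∈ (omitRelation hx ν m a).support ↔ ∃ k, k ≠ a ∧ x k = y := by
  rw [omitRelation, mem_support_conormalFamily]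
  refine exists_congr fun k => and_congr_left fun _ => ?_
  rw [Ne, smul_eq_zero, or_iff_left (h.ne_zero k), sub_eq_zero, h.injective.eq_iff]

theorem IsQuintupleConormals.exists_smul_eq (h : IsQuintupleConormals i x ν m)
    (hi : IsSurfaceImmersion i) (hx : Function.Injective x) {p : Space} (hxp : ∀ k, i (x k) = p)
    (hp : IsGenericMultiplePoint 5 i p) {l : F →₀ Covector} (hl : IsConormalRelation i p l)
    (hcard : l.support.card = 4) : ∃ (a : Fin 5) (c : ℝ), c ≠ 0 ∧ l = c • omitRelation hx ν m a := by
  classical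
  have hfib : range x = i ⁻¹' {p} := by
    refine (finite_of_encard_eq_coe hp.1).eq_of_subset_of_encard_le'
      (range_subset_iff.mpr hxp) ?_
    rw [hp.1]
    exact le_encard_of_injective_fin hx fun a => mem_range_self a
  have hsub : ∀ y ∈ l.support, ∃ k, x k = y := fun y hy => by
    have : y ∈ range x := by
      rw [hfib]
      exact hl.mem_fiber y hy
    exact this
  obtain ⟨a, ha⟩ : ∃ a, x a ∉ l.support := by
    by_contra! hall
    have h1 : Finset.univ.map ⟨x, hx⟩ ⊆ l.support := by
      intro y hy
      obtain ⟨k, -, rfl⟩ := Finset.mem_map.mp hy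
      exact hall k
    have h2 := Finset.card_le_card h1
    rw [Finset.card_map, Finset.card_univ, hcard] at h2
    simp at h2
  have hL0 : omitRelation hx ν m a ≠ 0 := by
    obtain ⟨k, hk⟩ := exists_ne a
    intro h0
    have := (h.mem_support hx a (x k)).mpr ⟨k, hk, rfl⟩
    rw [h0] at this
    simp at this
  obtain ⟨c, hc⟩ := (h.isConormalRelation hx hxp a).exists_smul_eq hi.2 hp.2 hl hL0
    (A := (Finset.univ.erase a).map ⟨x, hx⟩) (by simp) (fun y hy => by
      obtain ⟨k, hk, rfl⟩ := (h.mem_support hx a y).mp hy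
      exact Finset.mem_map_of_mem ⟨x, hx⟩ (by simp [hk])) (fun y hy => by
      obtain ⟨k, rfl⟩ := hsub y hy
      have hk : k ≠ a := fun hk => ha (hk ▸ hy)
      exact Finset.mem_map_of_mem ⟨x, hx⟩ (by simp [hk]))
  refine ⟨a, c, ?_, hc⟩
  rintro rfl
  rw [hc, zero_smul] at hcard
  simp at hcard

/-- There is a vector field along `i` with prescribed first order effect on the multiple points. -/
theorem IsQuintupleConormals.exists_contMDiff [IsManifold (𝓡 2) ∞ F] [T2Space F]
    (h : IsQuintupleConormals i x ν m)
    (hx : Function.Injective x) {p : Space} (hxp : ∀ k, i (x k) = p) {Q : Type*} [Fintype Q]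
    {q : Q → Space} (hq : Function.Injective q) (hqp : ∀ κ, q κ ≠ p) {rel : Q → F →₀ Covector}
    (hrel : ∀ κ, IsConormalRelation i (q κ) (rel κ)) (hrel0 : ∀ κ, rel κ ≠ 0) (s : Q → ℝ)
    (ρ : Fin 5 → ℝ) : ∃ V : F → Space, ContMDiff (𝓡 2) 𝓘(ℝ, Space) ∞ V ∧
      (∀ κ, ∃ c : ℝ, 0 < c ∧ crossingSpeed (linearDeformation i V) 0 (rel κ) = c * s κ) ∧
      ∀ k, ν k (V (x k)) = ρ k := by
  classical
  choose u' hu' using fun k => Covector.exists_apply_eq_one (h.ne_zero k)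
  have hex : ∀ κ y, ∃ u, rel κ y ≠ 0 → rel κ y u = 1 := by
    intro κ y
    by_cases h0 : rel κ y = 0
    · exact ⟨0, fun h1 => absurd h0 h1⟩
    · obtain ⟨u, hu⟩ := Covector.exists_apply_eq_one h0
      exact ⟨u, fun _ => hu⟩
  choose u hu using hex
  -- At a quadruple point `q κ` every participating sheet contributes `s κ` to the speed, so the
  -- factor `c` is the number of these sheets. Since `q` is injective, `i y` tells which `κ` applies
  -- at `y`.
  let w : F → Space := Function.extend x (fun k => ρ k • u' k)
    (fun y => Function.extend q (fun κ => s κ • u κ y) 0 (i y))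
  obtain ⟨V, hV, hVw⟩ := exists_contMDiff_eq_on_finset
    (Finset.univ.image x ∪ Finset.univ.biUnion fun κ => (rel κ).support) w
  refine ⟨V, hV, fun κ => ⟨(rel κ).support.card, ?_, ?_⟩, fun k => ?_⟩
  · exact_mod_cast Finset.card_pos.mpr (Finsupp.support_nonempty_iff.mpr (hrel0 κ))
  · have hterm : ∀ y ∈ (rel κ).support,
        rel κ y (velocity (linearDeformation i V) 0 y) = s κ := by
      intro y hy
      have hiy := (hrel κ).mem_fiber y hy
      have hnot : ¬ ∃ k, x k = y := by
        rintro ⟨k, rfl⟩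
        exact hqp κ (hiy.symm.trans (hxp k))
      have hwy : w y = s κ • u κ y := by
        simp only [w]
        rw [Function.extend_apply' _ _ _ hnot, hiy, hq.extend_apply]
      rw [velocity_linearDeformation, hVw y (Finset.mem_union_right _
        (Finset.mem_biUnion.mpr ⟨κ, Finset.mem_univ _, hy⟩)), hwy, map_smul,
        hu κ y (Finsupp.mem_support_iff.mp hy), smul_eq_mul, mul_one]
    rw [crossingSpeed, Finsupp.sum, Finset.sum_congr rfl hterm, Finset.sum_const, nsmul_eq_mul]
  · rw [hVw (x k) (Finset.mem_union_left _ (Finset.mem_image_of_mem x (Finset.mem_univ k)))]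
    simp only [w]
    rw [hx.extend_apply, map_smul, hu' k, smul_eq_mul, mul_one]

end QuintupleRelations

/-! ### The extension at a map with one sheet pushed. -/

section LinearDeformationSpeed

variable {F : Type*}

theorem crossingSpeed_linearDeformation_sub {i j V : F → Space} {r : ℝ} {l : F →₀ Covector}
    (h : ∀ y ∈ l.support, j y = i y) :
    crossingSpeed (linearDeformation j fun y => linearDeformation i V r y - j y) 0 l =
      r * crossingSpeed (linearDeformation i V) 0 l := by
  rw [crossingSpeed, crossingSpeed, Finsupp.sum, Finsupp.sum, Finset.mul_sum]
  refine Finset.sum_congr rfl fun y hy => ?_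
  rw [velocity_linearDeformation, velocity_linearDeformation, h y hy, linearDeformation,
    add_sub_cancel_left, map_smul, smul_eq_mul]

end LinearDeformationSpeed

section PushExtension

variable {F : Type*} [TopologicalSpace F] [ChartedSpace Plane F]

theorem PushesSheet.velocity_eq_zero {i : F → Space} {x₀ : F} {G : ℝ → F → Space}
    (hG : PushesSheet i x₀ G) {y : F} (hy : y ≠ x₀) (hu : i y ∈ unstablePoints i) :
    velocity G 0 y = 0 :=
  velocity_eq_zero_of_forall_eq (hG.2.2 y hy hu).self_of_nhds

variable [IsManifold (𝓡 2) ∞ F] [CompactSpace F]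

/-- The map obtained by pushing one sheet slightly off a quintuple point lies in `QuadImm F (n + 1)`,
and the extension of a `q`-invariant to it is a sum over sectors next to a ray. -/
theorem PushesSheet.eventually_hasExtensionValue [T2Space F] {i : F → Space}
    (hi : IsSurfaceImmersion i) (hgen : ∀ p, SheetsGeneric i p) {p : Space}
    (hp : IsGenericMultiplePoint 5 i p) {n : ℕ}
    (hn : (unstablePoints i \ {p}).encard = n)
    (hquad : ∀ q ∈ unstablePoints i \ {p}, IsGenericMultiplePoint 4 i q)
    {x : Fin 5 → F} (hx : Function.Injective x) (hxp : ∀ k, i (x k) = p)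
    {ν : Fin 5 → Covector} {m : Fin 5 → ℝ} (hνm : IsQuintupleConormals i x ν m)
    [Fintype (unstablePoints i)] [DecidableEq (unstablePoints i)] (p₀ : unstablePoints i)
    (hp₀ : (p₀ : Space) = p)
    {rel : {q : unstablePoints i // q ≠ p₀} → F →₀ Covector}
    (hrel : ∀ q, IsConormalRelation i q.1 (rel q)) (hrel0 : ∀ q, rel q ≠ 0)
    {k : Fin 5} {G : ℝ → F → Space} (hG : PushesSheet i (x k) G) :
    ∀ᶠ s in 𝓝[>] (0 : ℝ), G s ∈ QuadImm F (n + 1) ∧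
      ∀ f : QuadImm F 0 → ZMod 2, IsQInvariant f →
      ∀ g : ({q : unstablePoints i // q ≠ p₀} ⊕ Fin 5 → Bool) → ZMod 2,
        (∀ τ G', IsDeformation i G' → (∀ κ, 0 < boolSign (τ κ) *
          crossingSpeed G' 0 (Sum.elim rel (omitRelation hx ν m) κ)) →
          ∀ᶠ s in 𝓝[>] (0 : ℝ), ∃ h : G' s ∈ QuadImm F 0, f ⟨G' s, h⟩ = g τ) →
        HasExtensionValue f (G s) (∑ σ : unstablePoints i → Bool, g (Sum.elim (fun q => σ q.1)
          fun a => decide (a ∈ wallSide m k (ν k (velocity G 0 (x k))) (σ p₀)))) := by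
  subst hp₀
  have hqp : ∀ q : {q : unstablePoints i // q ≠ p₀}, (q.1 : Space) ≠ p₀ := fun q h =>
    q.2 (Subtype.ext h)
  have hfix : ∀ y, y ≠ x k → i y ∈ unstablePoints i → ∀ᶠ z in 𝓝 y, ∀ s ∈ Icc (0 : ℝ) 1,
      G s z = i z := hG.2.2
  have hxu : ∀ a, i (x a) ∈ unstablePoints i := fun a => by rw [hxp a]; exact p₀.2
  set e := ν k (velocity G 0 (x k)) with he
  have he0 : e ≠ 0 := fun h =>
    hG.2.1 ((hνm.conormal k).mem_sheetPlane (hi.2 _) (hνm.ne_zero k) h)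
  -- Only sheet `k` moves at `p`, so the push follows a ray in the wall `k` and lies off all other
  -- walls.
  have hGomit : ∀ a, crossingSpeed G 0 (omitRelation hx ν m a) = (m k - m a) * e := by
    intro a
    rw [crossingSpeed_omitRelation, Finset.sum_eq_single k]
    · intro b _ hb
      rw [hG.velocity_eq_zero (hx.ne hb) (hxu b), map_zero, mul_zero]
    · exact fun h => absurd (Finset.mem_univ k) h
  have hrelsupp : ∀ q, ∀ y ∈ (rel q).support, y ≠ x k ∧ i y ∈ unstablePoints i := by
    intro q y hy
    have h1 := (hrel q).mem_fiber y hy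
    refine ⟨?_, h1 ▸ q.1.2⟩
    rintro rfl
    exact hqp q (h1.symm.trans (hxp k))
  have homitsupp : ∀ y ∈ (omitRelation hx ν m k).support,
      y ≠ x k ∧ i y ∈ unstablePoints i := by
    intro y hy
    obtain ⟨b, hb, rfl⟩ := (hνm.mem_support hx k y).mp hy
    exact ⟨hx.ne hb, hxu b⟩
  -- the pattern of signs of a displacement to the side `σ` of the quadruple points of `G s`
  let τ : (unstablePoints i → Bool) → {q : unstablePoints i // q ≠ p₀} ⊕ Fin 5 → Bool :=
    fun σ => Sum.elim (fun q => σ q.1) fun a => decide (a ∈ wallSide m k e (σ p₀))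
  have hV : ∀ σ : unstablePoints i → Bool, ∃ V : F → Space,
      ContMDiff (𝓡 2) 𝓘(ℝ, Space) ∞ V ∧ ∀ κ, 0 < boolSign (τ σ κ) *
        crossingSpeed (linearDeformation i V) 0 (Sum.elim rel (omitRelation hx ν m) κ) := by
    intro σ
    obtain ⟨ρ, hρ⟩ := exists_displacement_wallSide hνm.injective k he0 (σ p₀)
    obtain ⟨V, hV, hVq, hVp⟩ := hνm.exists_contMDiff hx hxp
      (q := fun q : {q : unstablePoints i // q ≠ p₀} => (q.1 : Space))
      (Subtype.val_injective.comp Subtype.val_injective) hqp hrel hrel0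
      (fun q => boolSign (σ q.1)) ρ
    refine ⟨V, hV, ?_⟩
    rintro (q | a)
    · obtain ⟨c, hc, hcs⟩ := hVq q
      change 0 < boolSign (σ q.1) * crossingSpeed (linearDeformation i V) 0 (rel q)
      rw [hcs]
      nlinarith [boolSign_mul_self (σ q.1)]
    · change 0 < boolSign (decide (a ∈ wallSide m k e (σ p₀))) *
        crossingSpeed (linearDeformation i V) 0 (omitRelation hx ν m a)
      rw [crossingSpeed_omitRelation]
      have := hρ a
      simp only [velocity_linearDeformation, hVp]
      exact this
  choose V hV hVτ using hV
  have hVdef : ∀ σ, IsDeformation i (linearDeformation i (V σ)) := fun σ =>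
    isDeformation_linearDeformation hi.1 (hV σ)
  -- At `p`, the quadruples containing sheet `k` are moved to the same side by both deformations.
  -- The quadruple omitting sheet `k`, and those at the other points, are stationary under `G`.
  have hseg : ∀ σ, ∀ᶠ s in 𝓝[>] (0 : ℝ), ∀ᶠ r in 𝓝[>] (0 : ℝ), ∀ t ∈ Ioc (0 : ℝ) 1,
      (fun y => (1 - t) • G s y + t • linearDeformation i (V σ) r y) ∈ QuadImm F 0 := by
    intro σ
    refine (eventually_segment_mem_quadImm hi hgen hG.1 (hVdef σ) fun p' l hl hcard => ?_).curry
    have hp' := mem_unstablePoints_of_isConormalRelation hgen hl hcard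
    by_cases hpp : p' = p₀
    · subst hpp
      obtain ⟨a, c, hc, rfl⟩ := hνm.exists_smul_eq hi hx hxp hp hl hcard
      have hVa := hVτ σ (Sum.inr a)
      change 0 < boolSign (decide (a ∈ wallSide m k e (σ p₀))) *
        crossingSpeed (linearDeformation i (V σ)) 0 (omitRelation hx ν m a) at hVa
      have hcc : 0 < c * c := mul_self_pos.mpr hc
      by_cases ha : a = k
      · subst ha
        right
        refine ⟨?_, fun y hy => ?_⟩
        · rw [crossingSpeed_smul]
          exact mul_ne_zero hc (ne_zero_of_boolSign_mul_pos hVa)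
        · obtain ⟨h1, h2⟩ := homitsupp y (Finsupp.support_smul hy)
          exact hfix y h1 h2
      · left
        rw [crossingSpeed_smul, crossingSpeed_smul, hGomit]
        have hw : (decide (a ∈ wallSide m k e (σ p₀))) = decide (0 < (m k - m a) * e) := by
          simp only [wallSide, Finset.mem_filter, Finset.mem_univ, true_and, ha, if_false,
            mul_comm e]
        rw [hw] at hVa
        have h1 := mul_pos_of_boolSign_mul_pos (boolSign_decide_mul_pos
          (mul_ne_zero (sub_ne_zero.mpr (hνm.injective.ne (Ne.symm ha))) he0)) hVa
        nlinarith [mul_pos hcc h1]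
    · right
      let q : {q : unstablePoints i // q ≠ p₀} := ⟨⟨p', hp'⟩, fun h => hpp (congrArg Subtype.val h)⟩
      obtain ⟨c, rfl⟩ := (hquad p' ⟨hp', hpp⟩).exists_smul_eq hi (hrel q) (hrel0 q) hl
      have hc : c ≠ 0 := by
        rintro rfl
        simp at hcard
      refine ⟨?_, fun y hy => ?_⟩
      · rw [crossingSpeed_smul]
        exact mul_ne_zero hc (ne_zero_of_boolSign_mul_pos (hVτ σ (Sum.inl q)))
      · obtain ⟨h1, h2⟩ := hrelsupp q y (Finsupp.support_smul hy)
        exact hfix y h1 h2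
  have h4 : ∀ q ∈ unstablePoints i, (i ⁻¹' {q} \ {x k}).encard = 4 := by
    intro q hq
    by_cases hqp₀ : q = p₀
    · have h1 := encard_sdiff_singleton_add_one (s := i ⁻¹' {q}) (a := x k)
        (by rw [hqp₀]; exact hxp k)
      rw [show (i ⁻¹' {q}).encard = 5 by rw [hqp₀]; exact hp.1,
        show (5 : ℕ∞) = 4 + 1 by norm_num] at h1
      exact (ENat.add_left_injective_of_ne_top (by simp)) h1
    · rw [sdiff_singleton_eq_self]
      · exact (hquad q ⟨hq, hqp₀⟩).1
      · intro h
        exact hqp₀ (((hxp k).symm.trans h).symm)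
  filter_upwards [hG.eventually_fiber_eq hi hgen h4, eventually_all.mpr hseg,
    Ioo_mem_nhdsGT (zero_lt_one (α := ℝ))] with s hs hsseg hs01
  obtain ⟨hsimm, hsgen, hsu, hsfib⟩ := hs
  have hs01' : s ∈ Icc (0 : ℝ) 1 := ⟨hs01.1.le, hs01.2.le⟩
  have hj : G s ∈ QuadImm F (n + 1) := by
    refine ⟨hsimm, ?_, fun q hq => ⟨?_, hsgen q⟩⟩
    · rw [hsu, ← encard_sdiff_singleton_add_one p₀.2, hn]
      rfl
    · rw [hsu] at hq
      rw [hsfib q hq, h4 q hq]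
      rfl
  refine ⟨hj, fun f hf g hg => ?_⟩
  have hfixs : ∀ y, y ≠ x k → i y ∈ unstablePoints i → G s =ᶠ[𝓝 y] i := fun y hy hu => by
    filter_upwards [hfix y hy hu] with z hz
    exact hz s hs01'
  let relj : unstablePoints i → F →₀ Covector := fun q =>
    if h : q = p₀ then omitRelation hx ν m k else rel ⟨q, h⟩
  have hreljsupp : ∀ q, ∀ y ∈ (relj q).support, y ≠ x k ∧ i y ∈ unstablePoints i := by
    intro q y hy
    by_cases h : q = p₀
    · simp only [relj, h, dif_pos] at hy
      exact homitsupp y hy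
    · simp only [relj, h, dif_neg, not_false_iff] at hy
      exact hrelsupp _ y hy
  have hr : ∀ σ, ∃ r : ℝ, 0 < r ∧ (∀ t ∈ Ioc (0 : ℝ) 1,
      (fun y => (1 - t) • G s y + t • linearDeformation i (V σ) r y) ∈ QuadImm F 0) ∧
      ∃ h : linearDeformation i (V σ) r ∈ QuadImm F 0,
        f ⟨linearDeformation i (V σ) r, h⟩ = g (τ σ) := fun σ =>
    ((eventually_mem_nhdsWithin (a := (0 : ℝ)) (s := Ioi 0)).and
      ((hsseg σ).and (hg (τ σ) _ (hVdef σ) (hVτ σ)))).exists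
  choose r hr0 hrseg hrmem hrf using hr
  -- The resolutions of `G s` are the straight lines from `G s` to representatives of the adjacent
  -- sectors, reached by deforming `i` itself.
  refine hf.hasExtensionValue hj hsu (rel := relj)
    (R := fun σ => linearDeformation (G s) fun y => linearDeformation i (V σ) (r σ) y - G s y)
    (W := fun σ => g (τ σ)) (fun q => ?_) (fun q => ?_) (fun σ => ?_) (fun σ q => ?_) (fun σ => ?_)
  · have h1 : IsConormalRelation i q (relj q) := by
      by_cases h : q = p₀
      · subst h
        simp only [relj, dif_pos]
        exact hνm.isConormalRelation hx hxp k
      · simp only [relj, h, dif_neg, not_false_iff]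
        exact hrel ⟨q, h⟩
    exact h1.of_eventuallyEq fun y hy => hfixs y (hreljsupp q y hy).1 (hreljsupp q y hy).2
  · by_cases h : q = p₀
    · simp only [relj, h, dif_pos]
      obtain ⟨b, hb⟩ := exists_ne k
      exact Finsupp.support_nonempty_iff.mp
        ⟨x b, (hνm.mem_support hx k (x b)).mpr ⟨b, hb, rfl⟩⟩
    · simp only [relj, h, dif_neg, not_false_iff]
      exact hrel0 ⟨q, h⟩
  · exact isDeformation_linearDeformation hsimm.1 ((hrmem σ).1.1.sub hsimm.1)
  · rw [crossingSpeed_linearDeformation_sub fun y hy =>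
      (hfixs y (hreljsupp q y hy).1 (hreljsupp q y hy).2).self_of_nhds]
    have h1 : 0 < boolSign (σ q) * crossingSpeed (linearDeformation i (V σ)) 0 (relj q) := by
      by_cases h : q = p₀
      · subst h
        have h2 := hVτ σ (Sum.inr k)
        have h3 : τ σ (Sum.inr k) = σ q := by
          simp [τ, wallSide]
        rw [h3] at h2
        simp only [relj, dif_pos]
        exact h2
      · simp only [relj, h, dif_neg, not_false_iff]
        exact hVτ σ (Sum.inl ⟨q, h⟩)
    nlinarith [mul_pos (hr0 σ) h1]
  · have hline : ∀ t, (linearDeformation (G s)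
        (fun y => linearDeformation i (V σ) (r σ) y - G s y) t) =
        fun y => (1 - t) • G s y + t • linearDeformation i (V σ) (r σ) y := by
      intro t
      funext y
      rw [linearDeformation]
      module
    filter_upwards [Ioo_mem_nhdsGT (zero_lt_one (α := ℝ))] with t ht
    have hmem : (linearDeformation (G s)
        (fun y => linearDeformation i (V σ) (r σ) y - G s y) t) ∈ QuadImm F 0 := by
      rw [hline]
      exact hrseg σ t ⟨ht.1, ht.2.le⟩
    refine ⟨hmem, ?_⟩
    rw [← hrf σ]
    refine hf.eq_of_segment (fun u hu => ?_) hmem (hrmem σ)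
    -- The segment from the point at time `t` to the end is a reparametrised part of the whole
    -- segment.
    convert hrseg σ (t + u * (1 - t)) ⟨by nlinarith [ht.1, ht.2, hu.1],
      by nlinarith [ht.1, ht.2, hu.2]⟩ using 1
    funext y
    rw [hline]
    module

end PushExtension

/-! ### The 10 term relation. -/

theorem theorem2p1
    {F : Type*} [TopologicalSpace F] [T2Space F] [CompactSpace F]
    [ChartedSpace Plane F] [IsManifold (𝓡 2) ∞ F]
    -- an immersion with one generic quintuple point `p` and `n` generic quadruple points
    (i : F → Space) (hi : IsSurfaceImmersion i)
    (p : Space) (hp : IsGenericMultiplePoint 5 i p)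
    (n : ℕ) (hn : (unstablePoints i \ {p}).encard = n)
    (hquad : ∀ q ∈ unstablePoints i \ {p}, IsGenericMultiplePoint 4 i q)
    -- the five sheets through `p`
    (x : Fin 5 → F) (hx : Function.Injective x) (hxp : ∀ k, i (x k) = p)
    -- each of them is pushed away from `p` to either side
    (G : Fin 5 → Fin 2 → ℝ → F → Space) (hG : ∀ k l, PushesSheet i (x k) (G k l))
    (hside : ∀ k, PushesToOppositeSides i (x k) (G k 0) (G k 1)) :
    -- whenever the pushes are slight enough
    ∃ δ : ℝ, 0 < δ ∧ ∀ s : Fin 5 → Fin 2 → ℝ, (∀ k l, s k l ∈ Ioo 0 δ) →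
      (∀ k l, G k l (s k l) ∈ QuadImm F (n + 1)) ∧
      ∀ f : QuadImm F 0 → ZMod 2, IsQInvariant f →
        ∃ c : Fin 5 → Fin 2 → ZMod 2,
          (∀ k l, HasExtensionValue f (G k l (s k l)) (c k l)) ∧
          ∑ k, ∑ l, c k l = 0 := by
  classical
  have hpu : p ∈ unstablePoints i := fun h => by
    have := h.1
    rw [hp.1] at this
    norm_cast at this
  have hgen : ∀ q, SheetsGeneric i q := by
    intro q
    by_cases hq : q ∈ unstablePoints i
    · by_cases hqp : q = p
      · exact hqp ▸ hp.2
      · exact (hquad q ⟨hq, hqp⟩).2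
    · exact (not_not.mp hq).2
  have hfin : (unstablePoints i).Finite := by
    have h1 : (unstablePoints i \ {p}).Finite := finite_of_encard_eq_coe hn
    exact (h1.insert p).subset fun q hq => by
      by_cases hqp : q = p
      · exact Or.inl hqp
      · exact Or.inr ⟨hq, hqp⟩
  have : Fintype (unstablePoints i) := hfin.fintype
  obtain ⟨ν, m, hm, hν, hν0, hs0, hs1⟩ := exists_quintuple_conormals hi.2 hp.2 hx hxp
  have hνm : IsQuintupleConormals i x ν m := ⟨hm, hν, hν0, hs0, hs1⟩
  let p₀ : unstablePoints i := ⟨p, hpu⟩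
  have hqp : ∀ q : {q : unstablePoints i // q ≠ p₀}, (q.1 : Space) ≠ p := fun q h =>
    q.2 (Subtype.ext h)
  choose rel hrel hrel0 using fun q : {q : unstablePoints i // q ≠ p₀} =>
    (hquad q.1 ⟨q.1.2, hqp q⟩).exists_isConormalRelation hi
  have hmain : ∀ k l, ∀ᶠ s in 𝓝[>] (0 : ℝ), _ := fun k l =>
    (hG k l).eventually_hasExtensionValue hi hgen hp hn hquad hx hxp hνm p₀ rfl hrel hrel0
  -- The eventual statement already quantifies over all `q`-invariants, so one `δ` serves for all of
  -- them and for all ten pushes.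
  obtain ⟨δ, hδ, hsub⟩ := mem_nhdsGT_iff_exists_Ioo_subset.mp
    (eventually_all.mpr fun k => eventually_all.mpr fun l => hmain k l)
  refine ⟨δ, hδ, fun s hs => ⟨fun k l => (hsub (hs k l) k l).1, fun f hf => ?_⟩⟩
  have hcover : ∀ q l, IsConormalRelation i q l → l.support.card = 4 →
      ∃ (κ : {q : unstablePoints i // q ≠ p₀} ⊕ Fin 5) (c : ℝ), c ≠ 0 ∧
        l = c • Sum.elim rel (omitRelation hx ν m) κ := by
    intro q l hl hcard
    by_cases hqp : q = p
    · subst hqp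
      obtain ⟨a, c, hc, h⟩ := hνm.exists_smul_eq hi hx hxp hp hl hcard
      exact ⟨Sum.inr a, c, hc, h⟩
    · have hq := mem_unstablePoints_of_isConormalRelation hgen hl hcard
      let q' : {q : unstablePoints i // q ≠ p₀} := ⟨⟨q, hq⟩, fun h => hqp (congrArg Subtype.val h)⟩
      obtain ⟨c, rfl⟩ := (hquad q ⟨hq, hqp⟩).exists_smul_eq hi (hrel q') (hrel0 q') hl
      refine ⟨Sum.inl q', c, ?_, rfl⟩
      rintro rfl
      simp at hcard
  choose g hg using hf.exists_pattern_value hi hgen hcover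
  refine ⟨_, fun k l => (hsub (hs k l) k l).2 f hf g hg, ?_⟩
  -- The side chosen at `p` is separated from the sides at the other quadruple points, so that the
  -- wall count can be made with the latter held fixed.
  have hsplit : ∀ k l, ∑ σ : unstablePoints i → Bool, g (Sum.elim (fun q => σ q.1)
        fun a => decide (a ∈ wallSide m k (ν k (velocity (G k l) 0 (x k))) (σ p₀))) =
      ∑ σ : {q : unstablePoints i // q ≠ p₀} → Bool, ∑ b, g (Sum.elim σ
        fun a => decide (a ∈ wallSide m k (ν k (velocity (G k l) 0 (x k))) b)) := by
    intro k l
    rw [Finset.sum_comm, ← Fintype.sum_prod_type']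
    exact Fintype.sum_equiv (Equiv.funSplitAt p₀ Bool) _ _ fun σ => rfl
  simp only [hsplit]
  have hcomm : ∀ Φ : Fin 5 → Fin 2 → ({q : unstablePoints i // q ≠ p₀} → Bool) → ZMod 2,
      ∑ k, ∑ l, ∑ σ, Φ k l σ = ∑ σ, ∑ k, ∑ l, Φ k l σ := by
    intro Φ
    rw [Finset.sum_comm]
    rw [Finset.sum_congr rfl fun k _ => Finset.sum_comm]
    rw [Finset.sum_comm]
    refine Finset.sum_congr rfl fun σ _ => Finset.sum_comm
  rw [hcomm]
  refine Finset.sum_eq_zero fun σ _ => ?_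
  exact sum_wallSide_eq_zero hm (fun k => hside k (ν k) (hν k) (hν0 k))
    fun B => g (Sum.elim σ fun a => decide (a ∈ B))
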